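/- Model. Fix constants $0<\beta\le 1$ and $0<\alpha<1/2$. For each $N$ consider $N$ identical first-come-first-serve servers, each with its own queue. Jobs arrive according to a Poisson process of rate $N\lambda/k$, where $\lambda=\lambda_N=1-\beta N^{-\alpha}$; each job consists of $k=k_N$ tasks, and task service times are independent and exponential with rate $1$. Under batch-filling with probe overhead $d=d_N$, an arriving job samples $kd$ queues uniformly at random without replacement (that is, $\min\{\lfloor kd\rfloor, N\}$ queues), and its tasks are assigned one by one to a shortest sampled queue, the queue lengths being updated after each assignment; ties are broken by an arbitrary, possibly randomized, rule. Every queue has a buffer of size $b=\min\{N^{\alpha},N^{1/2-\alpha}/k\}$ including the task in service (it holds at most $\lfloor b\rfloor$ tasks); if some task of the job is routed to a full queue, the whole job is dropped, and otherwise it is admitted. The queue lengths form a continuous-time Markov chain on a finite state space. Consider a job that arrives in steady state, i.e. finds queue lengths distributed according to the stationary distribution of this chain. Let $p_{\mathrm d}$ be the probability that it is dropped, and, if it is admitted, let $T$ be its delay, the time from its arrival until all of its tasks are completed. Let $T^*$ be the maximum of $k$ independent exponential random variables with rate $1$ (the inherent delay of a job). All asymptotics are for $N\to\infty$, and $\log=\ln$.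 Theorem. Assume that $k=o\!\left(\frac{N^{1/2-\alpha}}{\log^2 N}\right)$ and $\frac{k}{\log k}=\Omega(\log N)$. (1) If $d\ge \frac{8}{(1-\lambda)h}$ for all sufficiently large $N$, for some $h=h_N$ with $h=\omega(1)$ and $h=o(\log k)$, then $$\mathbb{E}[T\mid \text{admitted}]=\ln k+o(\ln k),$$ and $p_{\mathrm d}\le \frac{11}{b\sqrt N\,\log N}$ for all sufficiently large $N$. (2) Consequently, if $d=\omega\!\left(\frac{1}{(1-\lambda)\log k}\right)$, then zero queueing delay is achieved asymptotically: $$\frac{\mathbb{E}[T\mid\text{admitted}]-\mathbb{E}[T^*]}{\mathbb{E}[T^*]}\to 0 .$$ -/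

import Mathlib

open Filter Topology MeasureTheory ProbabilityTheory Asymptotics

noncomputable section

namespace BatchFilling

/-- Load `lam = 1 - β N^(-α)` of the system with `N` servers. -/
def load (α β : ℝ) (N : ℕ) : ℝ := 1 - β * (N : ℝ) ^ (-α)

/-- The buffer parameter `b = min {N^α, N^(1/2 - α) / k}`. -/
def buffer (α : ℝ) (k N : ℕ) : ℝ :=
  min ((N : ℝ) ^ α) ((N : ℝ) ^ ((1 : ℝ) / 2 - α) / (k : ℝ))

/-- Data of one system: the number of tasks per job, the arrival rate of jobs, the (integer) buffer
capacity of each queue, including the task in service, and the number of queues sampled by each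
arriving job. -/
structure Params where
  tasks : ℕ
  rate : ℝ
  cap : ℕ
  samples : ℕ

/-- The system with `N` servers, `k` tasks per job, load `load α β N` (so that jobs arrive at rate
`N * load / k`), buffers of size `b = buffer α k N` (a queue holds at most `⌊b⌋` tasks) and probe
overhead `d` (`k d` queues are sampled, rounded down and capped at the number `N` of queues). -/
def params (α β : ℝ) (k : ℕ) (d : ℝ) (N : ℕ) : Params where
  tasks := k
  rate := (N : ℝ) * load α β N / (k : ℝ)
  cap := ⌊buffer α k N⌋₊
  samples := min ⌊(k : ℝ) * d⌋₊ N

/-- A vector of queue lengths of `N` servers. -/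
abbrev Queues (N : ℕ) := Fin N → ℕ

/-- The state space: all vectors of queue lengths that respect the buffer capacity. -/
def states (N cap : ℕ) : Finset (Queues N) :=
  Fintype.piFinset fun _ => Finset.range (cap + 1)

/-- A task is added to queue `j`. -/
def addTask {N : ℕ} (q : Queues N) (j : Fin N) : Queues N := Function.update q j (q j + 1)

/-- A task leaves queue `j`. -/
def removeTask {N : ℕ} (q : Queues N) (j : Fin N) : Queues N := Function.update q j (q j - 1)

/-- A possibly randomized rule for choosing a shortest queue: `w q A j` is the probability that
queue `j` is chosen when the queue lengths are `q` and the sampled queues are those in `A`. Only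
queues in `A` whose length is minimal in `A` may be chosen. -/
def IsShortestQueueRule {N : ℕ} (w : Queues N → Finset (Fin N) → Fin N → ℝ) : Prop :=
  ∀ (q : Queues N) (A : Finset (Fin N)), A.Nonempty →
    (∀ j, 0 ≤ w q A j) ∧ ∑ j, w q A j = 1 ∧
      ∀ j, w q A j ≠ 0 → j ∈ A ∧ ∀ i ∈ A, q j ≤ q i

/-- `fillExp w A n q F` is the expectation of `F q'`, where `q'` is the random vector of queue
lengths obtained from `q` after `n` rounds of batch-filling in the set `A` of sampled queues: in each
round one task is put into a shortest queue of `A`, and the queue lengths are updated. -/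
def fillExp {N : ℕ} (w : Queues N → Finset (Fin N) → Fin N → ℝ) (A : Finset (Fin N)) :
    ℕ → Queues N → (Queues N → ℝ) → ℝ
  | 0, q, F => F q
  | n + 1, q, F => ∑ j, w q A j * fillExp w A n (addTask q j) F

/-- Expectation of `F q'`, where `q'` is the vector of queue lengths after all the tasks of a job that
finds the queue lengths `q` have been assigned: a set of `P.samples` queues is drawn uniformly at
random without replacement, and the tasks are assigned to it by batch-filling. -/
def assignExp {N : ℕ} (P : Params) (w : Queues N → Finset (Fin N) → Fin N → ℝ)
    (q : Queues N) (F : Queues N → ℝ) : ℝ :=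
  (∑ A ∈ Finset.powersetCard P.samples (Finset.univ : Finset (Fin N)), fillExp w A P.tasks q F) /
    (N.choose P.samples : ℝ)

/-- The job is admitted iff no task is routed to a full queue. -/
def Admitted {N : ℕ} (cap : ℕ) (q' : Queues N) : Prop := ∀ j, q' j ≤ cap

open Classical in
/-- The state after an arrival: a job that is not admitted is discarded as a whole. -/
def afterArrival {N : ℕ} (cap : ℕ) (q q' : Queues N) : Queues N :=
  if Admitted cap q' then q' else q

/-- Generator of the continuous-time Markov chain of queue lengths: jobs arrive at rate `P.rate`, and
every nonempty queue loses a task at rate `1`. -/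
def generator {N : ℕ} (P : Params) (w : Queues N → Finset (Fin N) → Fin N → ℝ)
    (f : Queues N → ℝ) (q : Queues N) : ℝ :=
  P.rate * assignExp P w q (fun q' => f (afterArrival P.cap q q') - f q) +
    ∑ j with 0 < q j, (f (removeTask q j) - f q)

/-- `pi` is a stationary distribution of the chain on the (finite) state space. -/
def IsStationary {N : ℕ} (P : Params) (w : Queues N → Finset (Fin N) → Fin N → ℝ)
    (pi : Queues N → ℝ) : Prop :=
  (∀ q, 0 ≤ pi q) ∧ (∀ q, q ∉ states N P.cap → pi q = 0) ∧
    ∑ q ∈ states N P.cap, pi q = 1 ∧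
    ∀ f : Queues N → ℝ, ∑ q ∈ states N P.cap, pi q * generator P w f q = 0

/-- Expectation of `F q q'` for a job arriving in steady state, where `q` is the vector of queue lengths
that it finds, with distribution `pi`, and `q'` the one after the assignment of its tasks. -/
def arrivalExp {N : ℕ} (P : Params) (w : Queues N → Finset (Fin N) → Fin N → ℝ)
    (pi : Queues N → ℝ) (F : Queues N → Queues N → ℝ) : ℝ :=
  ∑ q ∈ states N P.cap, pi q * assignExp P w q (F q)

open Classical in
/-- Probability that a job arriving in steady state is dropped. -/
def dropProb {N : ℕ} (P : Params) (w : Queues N → Finset (Fin N) → Fin N → ℝ)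
    (pi : Queues N → ℝ) : ℝ :=
  arrivalExp P w pi fun _ q' => if Admitted P.cap q' then 0 else 1

/-- Law of the service times from the arrival of the job on: `x (j, i)` is the service time of the task
at position `i + 1` of queue `j` (the remaining one, if the task is in service at that moment). They
are independent and exponential with rate `1`. -/
def serviceLaw (N cap : ℕ) : Measure (Fin N × Fin cap → ℝ) :=
  Measure.pi fun _ => expMeasure 1

/-- Time until the task at position `p` of queue `j` is completed under first-come-first-serve. -/
def completionTime {N cap : ℕ} (x : Fin N × Fin cap → ℝ) (j : Fin N) (p : ℕ) : ℝ :=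
  ∑ i : Fin cap with i.val < p, x (j, i)

/-- Delay of an admitted job that changes the queue lengths from `q` to `q'`. Its tasks in queue `j`
are at the positions `p` with `q j < p ≤ q' j`, and it is completed when all of them are. -/
def jobDelay {N cap : ℕ} (q q' : Queues N) (x : Fin N × Fin cap → ℝ) : ℝ :=
  ⨆ t : {t : (j : Fin N) × Fin (q' j + 1) // q t.1 < (t.2 : ℕ)}, completionTime x t.1.1 t.1.2

open Classical in
/-- `E[T | admitted]`, the mean delay in steady state of a job, given that it is admitted. -/
def meanDelayAdmitted {N : ℕ} (P : Params) (w : Queues N → Finset (Fin N) → Fin N → ℝ)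
    (pi : Queues N → ℝ) : ℝ :=
  arrivalExp P w pi (fun q q' =>
      if Admitted P.cap q' then ∫ x, jobDelay q q' x ∂(serviceLaw N P.cap) else 0) /
    arrivalExp P w pi (fun _ q' => if Admitted P.cap q' then 1 else 0)

/-- `E[T*]`, the mean inherent delay: the mean of the maximum of `k` independent exponential service
times with rate `1`. -/
def meanInherentDelay (k : ℕ) : ℝ :=
  ∫ x : Fin k → ℝ, ⨆ i, x i ∂(Measure.pi fun _ => expMeasure 1)

end BatchFilling

end

noncomputable section
namespace BatchFilling

/-! ### Sampling without replacement -/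

/-! Write δ = 1 - λ = β N^(-α) and m = ⌈h⌉. The proof rests on two facts about the free places at
positions up to m.

Sampling: about kd ≥ 8k/(δm) queues are probed, so if the system has at least Nδm/4 free places up
to position m, the sample has about 2k of them on average. Maclaurin's inequality reduces sampling
without replacement to the independent case, and a Chernoff bound (`card_sample_small_le`) shows
that k places are available except with probability N^(-4). Batch-filling then puts nothing beyond m
(`fillExp_overflow_le`).

Stability: let `total` count all tasks, `excess` those beyond m, and `room` the free places up to m.
If room is small, almost all servers are busy and the total drifts down. If room is not small,
hardly any task arrives beyond m, so the excess drains, at a rate at least of order δ · excess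
because buffers are at most 1/δ. These regimes are glued by the Lyapunov function exp(θ · total) +
exp(θ (Nm - Nδm/2 + excess)). Since total + room = Nm + excess, its two exponents differ by θ (room
- Nδm/2), so room decides which term dominates, and once the larger exponent exceeds θN(m+1) the
dominant term has negative drift (`exp_drift_le`). The mean drift vanishes in steady state, which
makes a total of N(m+2) exponentially unlikely (`stationary_total_le`).

With fewer tasks than that there are N free places up to m+3, and sampling again shows that all
tasks of a job land at positions at most m+3, except with probability N^(-2). This bounds the drop
probability and makes the delay a maximum of k sums of at most m+3 exponentials. Through the moment
generating function at 1-η, its mean is at most (log k + (m+3) log(1/η))/(1-η), where m = o(log k)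
and η is arbitrary (`integral_iSup_le`). The tasks' own service times give the matching lower bound.
For the second part, `exists_level` supplies a suitable h. -/

lemma tangent_le_pow {a z : ℝ} (ha : 0 ≤ a) (hz : 0 ≤ z) (n : ℕ) :
    a ^ (n + 1) + (n + 1) * a ^ n * (z - a) ≤ z ^ (n + 1) := by
  induction n with
  | zero => simp
  | succ n ih =>
    have h1 := mul_le_mul_of_nonneg_left ih hz
    have h2 : 0 ≤ (n + 1 : ℝ) * a ^ n * (z - a) ^ 2 := by positivity
    push_cast
    calc _ = z * (a ^ (n + 1) + (n + 1) * a ^ n * (z - a)) - (n + 1 : ℝ) * a ^ n * (z - a) ^ 2 := by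
          ring
      _ ≤ z * z ^ (n + 1) := by linarith
      _ = _ := by ring

/-- Maclaurin's inequality between an elementary symmetric mean and the arithmetic mean. -/
lemma sum_powersetCard_prod_le {ι : Type*} (s : Finset ι) (y : ι → ℝ) (hy : ∀ i ∈ s, 0 ≤ y i)
    (n : ℕ) :
    ∑ A ∈ s.powersetCard n, ∏ i ∈ A, y i ≤
      (s.card.choose n : ℝ) * ((∑ i ∈ s, y i) / s.card) ^ n := by
  classical
  induction s using Finset.induction_on generalizing n with
  | empty =>
    cases n with
    | zero => simp
    | succ n => rw [Finset.powersetCard_eq_empty.2 (by simp)]; simp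
  | insert x s hx ih =>
    have hy' : ∀ i ∈ s, 0 ≤ y i := fun i hi => hy i (Finset.mem_insert_of_mem hi)
    have hyx : 0 ≤ y x := hy x (Finset.mem_insert_self _ _)
    cases n with
    | zero => simp
    | succ n =>
      have hdisj : Disjoint (s.powersetCard (n + 1)) ((s.powersetCard n).image (insert x)) := by
        rw [Finset.disjoint_left]
        intro A hA hA'
        obtain ⟨B, -, rfl⟩ := Finset.mem_image.1 hA'
        exact hx ((Finset.mem_powersetCard.1 hA).1 (Finset.mem_insert_self _ _))
      have hinj : Set.InjOn (insert x) (s.powersetCard n : Set (Finset ι)) := by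
        intro A hA B hB hAB
        have hxA : x ∉ A := fun h => hx ((Finset.mem_powersetCard.1 hA).1 h)
        have hxB : x ∉ B := fun h => hx ((Finset.mem_powersetCard.1 hB).1 h)
        rw [← Finset.erase_insert hxA, ← Finset.erase_insert hxB, hAB]
      rw [Finset.powersetCard_succ_insert hx, Finset.sum_union hdisj, Finset.sum_image hinj]
      have hprod : ∑ A ∈ s.powersetCard n, ∏ i ∈ insert x A, y i =
          y x * ∑ A ∈ s.powersetCard n, ∏ i ∈ A, y i := by
        rw [Finset.mul_sum]
        refine Finset.sum_congr rfl fun A hA => ?_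
        rw [Finset.prod_insert fun h => hx ((Finset.mem_powersetCard.1 hA).1 h)]
      rw [hprod, Finset.card_insert_of_notMem hx, Finset.sum_insert hx]
      obtain ⟨a, ha⟩ : ∃ a : ℝ, a = (∑ i ∈ s, y i) / s.card := ⟨_, rfl⟩
      simp only [← ha] at ih
      have ha0 : 0 ≤ a := ha ▸ div_nonneg (Finset.sum_nonneg hy') (Nat.cast_nonneg _)
      have hsum : ∑ i ∈ s, y i = s.card * a := by
        rcases s.eq_empty_or_nonempty with rfl | hs
        · simp
        · have : (s.card : ℝ) ≠ 0 := by exact_mod_cast hs.card_pos.ne'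
          rw [ha, mul_div_cancel₀ _ this]
      rw [hsum]
      obtain ⟨c, hc⟩ : ∃ c : ℝ, c = (s.card : ℝ) := ⟨_, rfl⟩
      have hc0 : 0 ≤ c := hc ▸ Nat.cast_nonneg _
      rw [Nat.cast_add_one, ← hc]
      -- The new element moves the mean from a to z. By Pascal's rule the two inductive bounds add
      -- up to the tangent at a of the convex function C(c+1, n+1) z^(n+1).
      have h1 := tangent_le_pow ha0 (z := (y x + c * a) / (c + 1)) (by positivity) n
      have h2 : ((s.card + 1).choose (n + 1) : ℝ) * (n + 1) = (c + 1) * s.card.choose n := by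
        have := Nat.add_one_mul_choose_eq s.card n
        rw [hc]; exact_mod_cast this.symm
      have h3 : ((s.card + 1).choose (n + 1) : ℝ) = s.card.choose n + s.card.choose (n + 1) := by
        exact_mod_cast Nat.choose_succ_succ s.card n
      calc _ ≤ (s.card.choose (n + 1) : ℝ) * a ^ (n + 1) + y x * (s.card.choose n * a ^ n) :=
            add_le_add (ih hy' (n + 1)) (mul_le_mul_of_nonneg_left (ih hy' n) hyx)
        _ = ((s.card + 1).choose (n + 1) : ℝ) * a ^ (n + 1) +
              (((s.card + 1).choose (n + 1) : ℝ) * (n + 1)) * a ^ n *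
                ((y x + c * a) / (c + 1) - a) := by
            rw [h2, h3]; field_simp; ring
        _ ≤ _ := by
            have := mul_le_mul_of_nonneg_left h1
              (Nat.cast_nonneg (α := ℝ) ((s.card + 1).choose (n + 1)))
            linarith

/-- The constant 3/8 is just below 1 - e^(-1/2), the slope of the chord over [0, 1]. A linear
majorant turns the mean of the capacities into a bound for the mean of their exponentials. -/
lemma exp_neg_half_le {x : ℝ} (h0 : 0 ≤ x) (h1 : x ≤ 1) :
    Real.exp (-(x / 2)) ≤ 1 - 3 / 8 * x := by
  have h := Real.quadratic_le_exp_of_nonneg (x := x / 2) (by linarith)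
  have hpos : 0 < 1 + x / 2 + (x / 2) ^ 2 / 2 := by positivity
  rw [Real.exp_neg]
  refine (inv_anti₀ hpos h).trans ?_
  rw [inv_le_iff_one_le_mul₀ hpos]
  nlinarith [mul_nonneg h0 h0, mul_nonneg h0 (sub_nonneg.2 h1),
    mul_nonneg (mul_nonneg h0 h0) (sub_nonneg.2 h1)]

/-- Chernoff bound for sampling without replacement: if the sample mean of the total capacity is at
least `1.9 k`, then a total capacity below `k` is exponentially unlikely. -/
lemma card_sample_small_le {N n k M : ℕ} (hN : 0 < N) (hM : 0 < M) (g : Fin N → ℕ)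
    (hg : ∀ j, g j ≤ M) (hk : 19 / 10 * (k : ℝ) * N ≤ n * ∑ j, (g j : ℝ)) :
    (∑ A ∈ Finset.powersetCard n (Finset.univ : Finset (Fin N)),
        if ∑ j ∈ A, g j < k then (1 : ℝ) else 0) ≤
      (N.choose n : ℝ) * Real.exp (-(k / (5 * M))) := by
  have hM' : (0 : ℝ) < M := by exact_mod_cast hM
  have hN' : (0 : ℝ) < N := by exact_mod_cast hN
  have hx0 : ∀ j, 0 ≤ (g j : ℝ) / M := fun j => by positivity
  have hx1 : ∀ j, (g j : ℝ) / M ≤ 1 := fun j => by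
    rw [div_le_one hM']; exact_mod_cast hg j
  -- Exponential Markov inequality with parameter 1/(2M).
  have hstep : ∀ A : Finset (Fin N), (if ∑ j ∈ A, g j < k then (1 : ℝ) else 0) ≤
      Real.exp (k / (2 * M)) * ∏ j ∈ A, Real.exp (-((g j : ℝ) / M / 2)) := by
    intro A
    rw [← Real.exp_sum, ← Real.exp_add]
    split_ifs with h
    · rw [← Real.exp_zero]
      apply Real.exp_le_exp.2
      have h' : ∑ j ∈ A, (g j : ℝ) ≤ k := by exact_mod_cast h.le
      have : ∑ j ∈ A, -((g j : ℝ) / M / 2) = -((∑ j ∈ A, (g j : ℝ)) / (2 * M)) := by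
        rw [Finset.sum_div, ← Finset.sum_neg_distrib]
        exact Finset.sum_congr rfl fun j _ => by field_simp
      rw [this, ← sub_eq_add_neg, ← sub_div]
      exact div_nonneg (by linarith) (by positivity)
    · positivity
  have hmac := sum_powersetCard_prod_le (Finset.univ : Finset (Fin N))
    (fun j => Real.exp (-((g j : ℝ) / M / 2))) (fun _ _ => (Real.exp_pos _).le) n
  rw [Finset.card_univ, Fintype.card_fin] at hmac
  set S : ℝ := ∑ j, (g j : ℝ) with hS
  have hmean : (∑ j : Fin N, Real.exp (-((g j : ℝ) / M / 2))) / N ≤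
      Real.exp (-(3 / 8 * (S / (N * M)))) := by
    calc _ ≤ (∑ j : Fin N, (1 - 3 / 8 * ((g j : ℝ) / M))) / N := by
          gcongr with j
          exact exp_neg_half_le (hx0 j) (hx1 j)
      _ = 1 - 3 / 8 * (S / (N * M)) := by
          rw [Finset.sum_sub_distrib, ← Finset.mul_sum, ← Finset.sum_div, ← hS]
          simp only [Finset.sum_const, Finset.card_univ, Fintype.card_fin, nsmul_eq_mul, mul_one]
          field_simp
      _ ≤ _ := by
          have := Real.add_one_le_exp (-(3 / 8 * (S / (N * M))))
          linarith
  calc _ ≤ ∑ A ∈ Finset.powersetCard n (Finset.univ : Finset (Fin N)),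
        Real.exp (k / (2 * M)) * ∏ j ∈ A, Real.exp (-((g j : ℝ) / M / 2)) :=
        Finset.sum_le_sum fun A _ => hstep A
    _ ≤ Real.exp (k / (2 * M)) * ((N.choose n : ℝ) *
          Real.exp (-(3 / 8 * (S / (N * M)))) ^ n) := by
        rw [← Finset.mul_sum]
        refine mul_le_mul_of_nonneg_left (hmac.trans ?_) (Real.exp_pos _).le
        gcongr
    _ = (N.choose n : ℝ) * Real.exp (k / (2 * M) + n * -(3 / 8 * (S / (N * M)))) := by
        rw [Real.exp_add, Real.exp_nat_mul]; ring
    _ ≤ _ := by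
        gcongr
        -- The constants fit because 3/8 · 19/10 = 0.7125 exceeds 1/2 + 1/5.
        have h1 : 19 / 10 * ((k : ℝ) / M) ≤ n * (S / (N * M)) := by
          rw [← mul_div_assoc, ← mul_div_assoc, div_le_div_iff₀ hM' (by positivity)]
          nlinarith
        have h2 : (k : ℝ) / (2 * M) = (k / M) / 2 := by field_simp
        have h3 : (k : ℝ) / (5 * M) = (k / M) / 5 := by field_simp
        have h4 : 0 ≤ (k : ℝ) / M := by positivity
        rw [h2, h3]
        linarith

end BatchFilling
end
noncomputable section
namespace BatchFilling

/-! ### The effect of batch-filling on the queue lengths -/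

/-- Total number of tasks. -/
def total {N : ℕ} (q : Queues N) : ℕ := ∑ j, q j

/-- Number of free places at the positions up to `M`. -/
def room {N : ℕ} (M : ℕ) (q : Queues N) : ℕ := ∑ j, (M - q j)

/-- Number of tasks at positions beyond `M`. -/
def excess {N : ℕ} (M : ℕ) (q : Queues N) : ℕ := ∑ j, (q j - M)

/-- Number of queues with more than `M` tasks. -/
def longer {N : ℕ} (M : ℕ) (q : Queues N) : ℕ := (Finset.univ.filter fun j => M < q j).card

/-- This conservation law lets the room alone decide which of the two Lyapunov exponents is larger.
-/
lemma total_add_room {N : ℕ} (M : ℕ) (q : Queues N) : total q + room M q = N * M + excess M q := by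
  have h : ∀ j, q j + (M - q j) = M + (q j - M) := fun j => by omega
  simp only [total, room, excess, ← Finset.sum_add_distrib, h]
  rw [Finset.sum_add_distrib]
  simp

/-- An empty queue contributes M free places, so little room forces most servers to be busy. -/
lemma mul_le_room_add {N : ℕ} (M : ℕ) (q : Queues N) : M * N ≤ room M q + M * longer 0 q := by
  have h : ∀ j, M ≤ (M - q j) + if 0 < q j then M else 0 := fun j => by split_ifs <;> omega
  calc M * N = ∑ _j : Fin N, M := by simp [mul_comm]
    _ ≤ ∑ j, ((M - q j) + if 0 < q j then M else 0) := Finset.sum_le_sum fun j _ => h j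
    _ = _ := by
      rw [Finset.sum_add_distrib, ← Finset.sum_filter]
      simp [room, longer, mul_comm]

lemma le_cap_of_mem_states {N cap : ℕ} {q : Queues N} (hq : q ∈ states N cap) (j : Fin N) :
    q j ≤ cap := by
  have := Fintype.mem_piFinset.1 hq j
  simpa [Nat.lt_succ_iff] using this

/-- Finite buffers convert a large excess into many long queues, hence into a large rate of
departures from the excess. -/
lemma excess_le {N cap : ℕ} (M : ℕ) {q : Queues N} (hq : ∀ j, q j ≤ cap) :
    excess M q ≤ cap * longer M q := by
  have h : ∀ j, q j - M ≤ if M < q j then cap else 0 := fun j => by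
    have := hq j
    split_ifs <;> omega
  calc excess M q ≤ ∑ j, if M < q j then cap else 0 := Finset.sum_le_sum fun j _ => h j
    _ = _ := by
      rw [← Finset.sum_filter]
      simp [longer, mul_comm]

lemma longer_le {N : ℕ} (M : ℕ) (q : Queues N) : longer M q ≤ N :=
  (Finset.card_filter_le _ _).trans (by simp)

lemma sum_comp_update {ι : Type*} [DecidableEq ι] {A : Finset ι} {j : ι} (hj : j ∈ A)
    (q : ι → ℕ) (v : ℕ) (φ : ℕ → ℕ) :
    ∑ i ∈ A, φ (Function.update q j v i) + φ (q j) = ∑ i ∈ A, φ (q i) + φ v := by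
  rw [← Finset.add_sum_erase A _ hj, ← Finset.add_sum_erase A (fun i => φ (q i)) hj]
  have : ∑ i ∈ A.erase j, φ (Function.update q j v i) = ∑ i ∈ A.erase j, φ (q i) :=
    Finset.sum_congr rfl fun i hi => by rw [Function.update_of_ne (Finset.ne_of_mem_erase hi)]
  rw [this, Function.update_self]
  ring

/-! ### Batch-filling in a fixed sample -/

variable {N : ℕ} {w : Queues N → Finset (Fin N) → Fin N → ℝ}

/-- The invariant is indexed by the number of tasks still to be placed. The rule has no weight
outside the shortest queues of A, so only such choices must preserve it, whatever the tie-breaking.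
-/
lemma fillExp_le_of_invariant (hw : IsShortestQueueRule w) {A : Finset (Fin N)} (hA : A.Nonempty)
    (I : ℕ → Queues N → Prop)
    (hI : ∀ n q j, I (n + 1) q → j ∈ A → (∀ i ∈ A, q j ≤ q i) → I n (addTask q j))
    {F G : Queues N → ℝ} (hFG : ∀ q, I 0 q → F q ≤ G q) (n : ℕ) (q : Queues N) (hq : I n q) :
    fillExp w A n q F ≤ fillExp w A n q G := by
  induction n generalizing q with
  | zero => exact hFG q hq
  | succ n ih =>
    simp only [fillExp]
    refine Finset.sum_le_sum fun j _ => ?_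
    obtain ⟨h0, -, h2⟩ := hw q A hA
    by_cases hj : w q A j = 0
    · simp [hj]
    · obtain ⟨hjA, hmin⟩ := h2 j hj
      exact mul_le_mul_of_nonneg_left (ih _ (hI n q j hq hjA hmin)) (h0 j)

lemma fillExp_const (hw : IsShortestQueueRule w) {A : Finset (Fin N)} (hA : A.Nonempty) (c : ℝ)
    (n : ℕ) (q : Queues N) : fillExp w A n q (fun _ => c) = c := by
  induction n generalizing q with
  | zero => rfl
  | succ n ih =>
    simp only [fillExp, ih]
    rw [← Finset.sum_mul, (hw q A hA).2.1, one_mul]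

lemma fillExp_add (A : Finset (Fin N)) (F G : Queues N → ℝ) (n : ℕ) (q : Queues N) :
    fillExp w A n q (fun q' => F q' + G q') = fillExp w A n q F + fillExp w A n q G := by
  induction n generalizing q with
  | zero => rfl
  | succ n ih => simp only [fillExp, ih, mul_add, Finset.sum_add_distrib]

lemma fillExp_const_mul (A : Finset (Fin N)) (c : ℝ) (F : Queues N → ℝ) (n : ℕ) (q : Queues N) :
    fillExp w A n q (fun q' => c * F q') = c * fillExp w A n q F := by
  induction n generalizing q with
  | zero => rfl
  | succ n ih =>
    simp only [fillExp, ih, Finset.mul_sum]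
    exact Finset.sum_congr rfl fun j _ => by ring

/-- What can be said about the queue lengths after `n` tasks have been added to `q`. -/
def Added (n : ℕ) (q q' : Queues N) : Prop := (∀ j, q j ≤ q' j) ∧ total q' = total q + n

lemma total_addTask (q : Queues N) (j : Fin N) : total (addTask q j) = total q + 1 := by
  have := sum_comp_update (Finset.mem_univ j) q (q j + 1) id
  simp only [id] at this
  simp only [total, addTask]
  omega

lemma fillExp_le (hw : IsShortestQueueRule w) {A : Finset (Fin N)} (hA : A.Nonempty)
    {F G : Queues N → ℝ} {n : ℕ} {q : Queues N} (hFG : ∀ q', Added n q q' → F q' ≤ G q') :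
    fillExp w A n q F ≤ fillExp w A n q G := by
  refine fillExp_le_of_invariant hw hA
    (fun l q' => (∀ j, q j ≤ q' j) ∧ total q' + l = total q + n) ?_ ?_ n q ⟨fun _ => le_rfl, rfl⟩
  · rintro l q' j ⟨h1, h2⟩ - -
    refine ⟨fun i => (h1 i).trans ?_, ?_⟩
    · rcases eq_or_ne i j with rfl | h
      · simp [addTask]
      · simp [addTask, h]
    · rw [total_addTask]; omega
  · rintro q' ⟨h1, h2⟩
    exact hFG q' ⟨h1, by omega⟩

/-- Some task has been put at a position beyond `M`. -/
def Overflow (M : ℕ) (q q' : Queues N) : Prop := ∃ j, max (q j) M < q' j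

open Classical in
/-- Indicator of `Overflow`. -/
def overflowInd (M : ℕ) (q q' : Queues N) : ℝ := if Overflow M q q' then 1 else 0

lemma overflowInd_nonneg (M : ℕ) (q q' : Queues N) : 0 ≤ overflowInd M q q' := by
  unfold overflowInd; split_ifs <;> norm_num

lemma overflowInd_le_one (M : ℕ) (q q' : Queues N) : overflowInd M q q' ≤ 1 := by
  unfold overflowInd; split_ifs <;> norm_num

lemma fillExp_overflow_le (hw : IsShortestQueueRule w) {A : Finset (Fin N)} (hA : A.Nonempty)
    {M n : ℕ} {q : Queues N} :
    fillExp w A n q (overflowInd M q) ≤ if ∑ j ∈ A, (M - q j) < n then 1 else 0 := by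
  split_ifs with h
  · calc _ ≤ fillExp w A n q (fun _ => 1) := fillExp_le hw hA fun _ _ => overflowInd_le_one _ _ _
      _ = 1 := fillExp_const hw hA 1 n q
  · rw [← fillExp_const hw hA 0 n q]
    -- While the sample has at least as many free places up to M as tasks left to place, the
    -- shortest sampled queue is shorter than M: otherwise there would be no free place at all.
    refine fillExp_le_of_invariant hw hA
      (fun l q' => (∀ j, q' j ≤ max (q j) M) ∧ l ≤ ∑ j ∈ A, (M - q' j)) ?_ ?_ n q
      ⟨fun _ => le_max_left _ _, not_lt.1 h⟩
    · rintro l q' j ⟨h1, h2⟩ hj hmin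
      have hlt : q' j < M := by
        by_contra hM
        have : ∑ i ∈ A, (M - q' i) = 0 := Finset.sum_eq_zero fun i hi => by
          have := hmin i hi
          omega
        omega
      refine ⟨fun i => ?_, ?_⟩
      · rcases eq_or_ne i j with rfl | h
        · simp only [addTask, Function.update_self]
          exact le_max_of_le_right hlt
        · simpa [addTask, h] using h1 i
      · have := sum_comp_update hj q' (q' j + 1) (fun x => M - x)
        simp only [addTask]
        omega
    · rintro q' ⟨h1, -⟩
      have : ¬ Overflow M q q' := fun ⟨j, hj⟩ => (h1 j).not_gt hj
      simp [overflowInd, this]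

/-! ### Averaging over the random sample -/

variable {P : Params}

lemma nonempty_of_mem_powersetCard (hs : 0 < P.samples) {A : Finset (Fin N)}
    (hA : A ∈ Finset.powersetCard P.samples Finset.univ) : A.Nonempty := by
  rw [← Finset.card_pos, (Finset.mem_powersetCard.1 hA).2]
  exact hs

lemma choose_samples_pos (hN : P.samples ≤ N) : (0 : ℝ) < N.choose P.samples := by
  exact_mod_cast Nat.choose_pos hN

lemma assignExp_le (hw : IsShortestQueueRule w) (hs : 0 < P.samples) {F G : Queues N → ℝ}
    {q : Queues N} (hFG : ∀ q', Added P.tasks q q' → F q' ≤ G q') :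
    assignExp P w q F ≤ assignExp P w q G := by
  unfold assignExp
  gcongr with A hA
  exact fillExp_le hw (nonempty_of_mem_powersetCard hs hA) hFG

lemma assignExp_const (hw : IsShortestQueueRule w) (hs : 0 < P.samples) (hN : P.samples ≤ N)
    (c : ℝ) (q : Queues N) : assignExp P w q (fun _ => c) = c := by
  unfold assignExp
  rw [Finset.sum_congr rfl fun A hA =>
    fillExp_const hw (nonempty_of_mem_powersetCard hs hA) c P.tasks q]
  have := (choose_samples_pos hN).ne'
  simp only [Finset.sum_const, Finset.card_powersetCard, Finset.card_univ, Fintype.card_fin,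
    nsmul_eq_mul]
  field_simp

lemma assignExp_add (F G : Queues N → ℝ) (q : Queues N) :
    assignExp P w q (fun q' => F q' + G q') = assignExp P w q F + assignExp P w q G := by
  simp only [assignExp, fillExp_add, Finset.sum_add_distrib, add_div]

lemma assignExp_const_mul (c : ℝ) (F : Queues N → ℝ) (q : Queues N) :
    assignExp P w q (fun q' => c * F q') = c * assignExp P w q F := by
  simp only [assignExp, fillExp_const_mul, ← Finset.mul_sum, mul_div_assoc]

lemma assignExp_overflow_le_one (hw : IsShortestQueueRule w) (hs : 0 < P.samples)
    (hN : P.samples ≤ N) (M : ℕ) (q : Queues N) : assignExp P w q (overflowInd M q) ≤ 1 :=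
  (assignExp_le hw hs fun _ _ => overflowInd_le_one _ _ _).trans
    (assignExp_const hw hs hN 1 q).le

/-- If the mean number of free places in the sample is at least `1.9` times the number of tasks,
then it is unlikely that a task is put at a position beyond `M`. -/
lemma assignExp_overflow_le (hw : IsShortestQueueRule w) (hs : 0 < P.samples)
    (hN : P.samples ≤ N) {M : ℕ} (hM : 0 < M) {q : Queues N}
    (hr : 19 / 10 * (P.tasks : ℝ) * N ≤ P.samples * room M q) :
    assignExp P w q (overflowInd M q) ≤ Real.exp (-(P.tasks / (5 * M))) := by
  have hc := choose_samples_pos hN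
  unfold assignExp
  rw [div_le_iff₀ hc, mul_comm]
  refine (Finset.sum_le_sum fun A hA =>
    fillExp_overflow_le hw (nonempty_of_mem_powersetCard hs hA)).trans ?_
  refine card_sample_small_le (hs.trans_le hN) hM (fun j => M - q j) (fun j => Nat.sub_le _ _) ?_
  simpa [room] using hr

end BatchFilling
end
noncomputable section
namespace BatchFilling

/-! ### An exponential Lyapunov function -/

variable {N : ℕ} {w : Queues N → Finset (Fin N) → Fin N → ℝ} {P : Params}

lemma generator_add (f g : Queues N → ℝ) (q : Queues N) :
    generator P w (fun q => f q + g q) q = generator P w f q + generator P w g q := by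
  have h1 : (fun q' => f (afterArrival P.cap q q') + g (afterArrival P.cap q q') - (f q + g q)) =
      fun q' => (f (afterArrival P.cap q q') - f q) + (g (afterArrival P.cap q q') - g q) := by
    funext q'; ring
  have h2 : ∀ j, f (removeTask q j) + g (removeTask q j) - (f q + g q) =
      (f (removeTask q j) - f q) + (g (removeTask q j) - g q) := fun j => by ring
  simp only [generator, h1, assignExp_add, h2, Finset.sum_add_distrib]
  ring

lemma excess_le_of_added {M n : ℕ} {q q' : Queues N} (h : Added n q q') :
    excess M q' ≤ excess M q + n := by
  have h1 : ∀ j, (q' j - M) + q j ≤ (q j - M) + q' j := fun j => by have := h.1 j; omega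
  have h2 := Finset.sum_le_sum fun j (_ : j ∈ Finset.univ) => h1 j
  have h3 := h.2
  simp only [Finset.sum_add_distrib] at h2
  simp only [excess, total] at *
  omega

lemma excess_le_of_not_overflow {M : ℕ} {q q' : Queues N} (h : ¬ Overflow M q q') :
    excess M q' ≤ excess M q := by
  refine Finset.sum_le_sum fun j _ => ?_
  have : ¬ max (q j) M < q' j := fun hj => h ⟨j, hj⟩
  omega

lemma total_removeTask {q : Queues N} {j : Fin N} (hj : 0 < q j) :
    total (removeTask q j) + 1 = total q := by
  have := sum_comp_update (Finset.mem_univ j) q (q j - 1) id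
  simp only [id] at this
  simp only [total, removeTask]
  omega

lemma excess_removeTask (M : ℕ) (q : Queues N) (j : Fin N) :
    excess M (removeTask q j) + (if M < q j then 1 else 0) = excess M q := by
  have := sum_comp_update (Finset.mem_univ j) q (q j - 1) (fun x => x - M)
  simp only [excess, removeTask]
  split_ifs <;> omega

/-- An arrival adds at most k tasks, whether the job is admitted or dropped, and each busy server
removes one at rate 1. -/
lemma generator_exp_total_le (hw : IsShortestQueueRule w) (hs : 0 < P.samples)
    (hN : P.samples ≤ N) (hrate : 0 ≤ P.rate) {θ : ℝ} (hθ : 0 ≤ θ) (q : Queues N) :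
    generator P w (fun q => Real.exp (θ * total q)) q ≤
      Real.exp (θ * total q) *
        (P.rate * (Real.exp (θ * P.tasks) - 1) - longer 0 q * (1 - Real.exp (-θ))) := by
  have h1 : assignExp P w q (fun q' =>
      Real.exp (θ * total (afterArrival P.cap q q')) - Real.exp (θ * total q)) ≤
        Real.exp (θ * total q) * (Real.exp (θ * P.tasks) - 1) := by
    rw [← assignExp_const hw hs hN (Real.exp (θ * total q) * (Real.exp (θ * P.tasks) - 1)) q]
    refine assignExp_le hw hs fun q' hq' => ?_
    have : total (afterArrival P.cap q q') ≤ total q + P.tasks := by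
      unfold afterArrival
      split_ifs
      · exact hq'.2.le
      · exact Nat.le_add_right _ _
    have h : (total (afterArrival P.cap q q') : ℝ) ≤ total q + P.tasks := by exact_mod_cast this
    rw [mul_sub, ← Real.exp_add, mul_one]
    have := Real.exp_le_exp.2 (mul_le_mul_of_nonneg_left h hθ)
    rw [mul_add] at this
    linarith
  have h2 : ∑ j with 0 < q j,
      (Real.exp (θ * total (removeTask q j)) - Real.exp (θ * total q)) =
        -(Real.exp (θ * total q) * (longer 0 q * (1 - Real.exp (-θ)))) := by
    rw [Finset.sum_congr rfl (g := fun _ => Real.exp (θ * total q) * (Real.exp (-θ) - 1))]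
    · simp only [Finset.sum_const, nsmul_eq_mul, longer]; ring
    · intro j hj
      have : (total (removeTask q j) : ℝ) + 1 = total q := by
        exact_mod_cast total_removeTask (Finset.mem_filter.1 hj).2
      rw [mul_sub, ← Real.exp_add, mul_one, ← this]
      ring_nf
  unfold generator
  rw [h2]
  have := mul_le_mul_of_nonneg_left h1 hrate
  linarith

/-- The excess can grow only through an overflow, by at most k, and it shrinks exactly at departures
from queues longer than M. -/
lemma generator_exp_excess_le (hw : IsShortestQueueRule w) (hs : 0 < P.samples)
    (hrate : 0 ≤ P.rate) {θ : ℝ} (hθ : 0 ≤ θ) (c : ℝ) (M : ℕ)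
    (q : Queues N) :
    generator P w (fun q => Real.exp (θ * (c + excess M q))) q ≤
      Real.exp (θ * (c + excess M q)) *
        (P.rate * (Real.exp (θ * P.tasks) - 1) * assignExp P w q (overflowInd M q) -
          longer M q * (1 - Real.exp (-θ))) := by
  have h1 : assignExp P w q (fun q' =>
      Real.exp (θ * (c + excess M (afterArrival P.cap q q'))) -
        Real.exp (θ * (c + excess M q))) ≤
        Real.exp (θ * (c + excess M q)) * (Real.exp (θ * P.tasks) - 1) *
          assignExp P w q (overflowInd M q) := by
    rw [← assignExp_const_mul]
    refine assignExp_le hw hs fun q' hq' => ?_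
    by_cases ho : Overflow M q q'
    · have : excess M (afterArrival P.cap q q') ≤ excess M q + P.tasks := by
        unfold afterArrival
        split_ifs
        · exact excess_le_of_added hq'
        · exact Nat.le_add_right _ _
      have h : (excess M (afterArrival P.cap q q') : ℝ) ≤ excess M q + P.tasks := by
        exact_mod_cast this
      simp only [overflowInd, ho, if_true, mul_one]
      rw [mul_sub, ← Real.exp_add, mul_one]
      have := Real.exp_le_exp.2 (mul_le_mul_of_nonneg_left (add_le_add_right h c) hθ)
      rw [← add_assoc, mul_add _ (c + _)] at this
      linarith
    · have : excess M (afterArrival P.cap q q') ≤ excess M q := by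
        unfold afterArrival
        split_ifs
        · exact excess_le_of_not_overflow ho
        · exact le_rfl
      have h : (excess M (afterArrival P.cap q q') : ℝ) ≤ excess M q := by
        exact_mod_cast this
      simp only [overflowInd, ho, if_false, mul_zero]
      have := Real.exp_le_exp.2 (mul_le_mul_of_nonneg_left (add_le_add_right h c) hθ)
      linarith
  have h2 : ∑ j with 0 < q j,
      (Real.exp (θ * (c + excess M (removeTask q j))) - Real.exp (θ * (c + excess M q))) =
        -(Real.exp (θ * (c + excess M q)) * (longer M q * (1 - Real.exp (-θ)))) := by
    rw [Finset.sum_congr rfl (g := fun j => if M < q j then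
      Real.exp (θ * (c + excess M q)) * (Real.exp (-θ) - 1) else 0)]
    · rw [← Finset.sum_filter, Finset.filter_filter]
      have : (Finset.univ.filter fun j => 0 < q j ∧ M < q j) =
          Finset.univ.filter fun j => M < q j :=
        Finset.filter_congr fun j _ => ⟨fun h => h.2, fun h => ⟨by omega, h⟩⟩
      rw [this]
      simp only [Finset.sum_const, nsmul_eq_mul, longer]; ring
    · intro j _
      have := excess_removeTask M q j
      split_ifs at this ⊢ with h
      · have : (excess M (removeTask q j) : ℝ) + 1 = excess M q := by exact_mod_cast this
        rw [mul_sub, ← Real.exp_add, mul_one, ← this]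
        ring_nf
      · rw [add_zero] at this
        rw [this, sub_self]
  unfold generator
  rw [h2]
  have := mul_le_mul_of_nonneg_left h1 hrate
  linarith

/-- Standing assumptions on a system with `N` servers and load `1 - δ` that make a total of
`N (m + 2)` tasks unlikely; `ε` bounds the probability of `Overflow`. -/
structure Admissible (N : ℕ) (P : Params) (w : Queues N → Finset (Fin N) → Fin N → ℝ)
    (δ ε : ℝ) (m : ℕ) : Prop where
  rule : IsShortestQueueRule w
  samples_pos : 0 < P.samples
  samples_le : P.samples ≤ N
  tasks_pos : 0 < P.tasks
  rate_eq : P.rate = N * (1 - δ) / P.tasks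
  delta_pos : 0 < δ
  delta_le : δ ≤ 1
  m_pos : 0 < m
  cap_le : P.cap * δ ≤ 1
  eps_le : ε ≤ δ / 32
  overflow_le : ∀ M, m ≤ M → M ≤ m + 3 → ∀ q : Queues N, N * (δ * m / 4) ≤ room M q →
    assignExp P w q (overflowInd M q) ≤ ε
  -- The exponent is θNδm/4 with the θ of `theta`. It makes one Lyapunov term negligible when room
  -- is off its threshold Nδm/2 by Nδm/4.
  exp_le : Real.exp (-(δ ^ 2 * N * m / (64 * P.tasks))) ≤ δ / 32

lemma exp_sub_one_le {x : ℝ} (h0 : 0 ≤ x) (h1 : x ≤ 1) : Real.exp x - 1 ≤ x + x ^ 2 := by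
  have := Real.abs_exp_sub_one_sub_id_le (x := x) (by rwa [abs_of_nonneg h0])
  have := (abs_le.1 this).2
  linarith

lemma le_one_sub_exp_neg {x : ℝ} (h0 : 0 ≤ x) (h1 : x ≤ 1) : x - x ^ 2 ≤ 1 - Real.exp (-x) := by
  have := Real.abs_exp_sub_one_sub_id_le (x := -x) (by rwa [abs_neg, abs_of_nonneg h0])
  have := (abs_le.1 this).2
  nlinarith

/-! ### Drift of the two exponentials and its consequence in steady state -/

namespace Admissible

variable {δ ε : ℝ} {m : ℕ}

/-- Exponent of the Lyapunov function. -/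
def theta (P : Params) (δ : ℝ) : ℝ := δ / (16 * P.tasks)

/-- Lyapunov function. -/
def lyapunov (N : ℕ) (P : Params) (δ : ℝ) (m : ℕ) (q : Queues N) : ℝ :=
  Real.exp (theta P δ * total q) +
    Real.exp (theta P δ * ((N * m - N * (δ * m / 2)) + excess m q))

lemma theta_pos (hA : Admissible N P w δ ε m) : 0 < theta P δ := by
  have := hA.delta_pos
  have : (0 : ℝ) < P.tasks := by exact_mod_cast hA.tasks_pos
  unfold theta; positivity

lemma theta_mul_tasks (hA : Admissible N P w δ ε m) : theta P δ * P.tasks = δ / 16 := by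
  have : (0 : ℝ) < P.tasks := by exact_mod_cast hA.tasks_pos
  unfold theta; field_simp

lemma theta_le (hA : Admissible N P w δ ε m) : theta P δ ≤ δ / 16 := by
  have h1 : (1 : ℝ) ≤ P.tasks := by exact_mod_cast hA.tasks_pos
  have := hA.theta_mul_tasks
  nlinarith [hA.theta_pos]

lemma rate_nonneg (hA : Admissible N P w δ ε m) : 0 ≤ P.rate := by
  have := hA.delta_le
  rw [hA.rate_eq]
  exact div_nonneg (mul_nonneg (Nat.cast_nonneg _) (by linarith)) (Nat.cast_nonneg _)

lemma rate_mul_le (hA : Admissible N P w δ ε m) :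
    P.rate * (Real.exp (theta P δ * P.tasks) - 1) ≤ N * theta P δ * (1 - δ + δ / 16) := by
  have hk : (0 : ℝ) < P.tasks := by exact_mod_cast hA.tasks_pos
  have hδ := hA.delta_pos
  have hδ1 := hA.delta_le
  have ht := hA.theta_mul_tasks
  have h := exp_sub_one_le (x := theta P δ * P.tasks) (by rw [ht]; positivity)
    (by rw [ht]; linarith)
  have h2 := mul_le_mul_of_nonneg_left h hA.rate_nonneg
  refine h2.trans ?_
  have h3 : P.rate * (theta P δ * P.tasks + (theta P δ * P.tasks) ^ 2) =
      N * theta P δ * ((1 - δ) * (1 + δ / 16)) := by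
    have : (theta P δ * P.tasks) ^ 2 = theta P δ * P.tasks * (δ / 16) := by rw [sq, ht]
    rw [this, hA.rate_eq]
    field_simp
  rw [h3]
  have := hA.theta_pos
  gcongr
  nlinarith

/-- The loss δ/8 consists of two second-order errors of δ/16, one from e^(θk) - 1, as θk = δ/16, and
one from 1 - e^(-θ), as θ ≤ δ/16. -/
lemma generator_total_le (hA : Admissible N P w δ ε m) (q : Queues N) :
    generator P w (fun q => Real.exp (theta P δ * total q)) q ≤
      theta P δ * Real.exp (theta P δ * total q) * (N * (1 - δ + δ / 8) - longer 0 q) := by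
  have hθ := hA.theta_pos
  have hθ1 := hA.theta_le
  have hδ1 := hA.delta_le
  refine (generator_exp_total_le hA.rule hA.samples_pos hA.samples_le hA.rate_nonneg hθ.le
    q).trans ?_
  rw [mul_comm (theta P δ) (Real.exp _), mul_assoc (Real.exp _) (theta P δ)]
  refine mul_le_mul_of_nonneg_left ?_ (Real.exp_pos _).le
  have h1 := hA.rate_mul_le
  have h2 := le_one_sub_exp_neg hθ.le (by linarith)
  have h3 := mul_le_mul_of_nonneg_left h2 (Nat.cast_nonneg (α := ℝ) (longer 0 q))
  have h4 : (longer 0 q : ℝ) ≤ N := by exact_mod_cast longer_le 0 q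
  have h5 : (longer 0 q : ℝ) * theta P δ ^ 2 ≤ N * (theta P δ * (δ / 16)) := by
    rw [sq]; gcongr
  linarith

lemma generator_excess_le (hA : Admissible N P w δ ε m) (c : ℝ) (q : Queues N) :
    generator P w (fun q => Real.exp (theta P δ * (c + excess m q))) q ≤
      theta P δ * Real.exp (theta P δ * (c + excess m q)) *
        (N * assignExp P w q (overflowInd m q) - longer m q / 2) := by
  have hθ := hA.theta_pos
  have hθ1 := hA.theta_le
  have hδ1 := hA.delta_le
  have hδ := hA.delta_pos
  refine (generator_exp_excess_le hA.rule hA.samples_pos hA.rate_nonneg hθ.le c m q).trans ?_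
  rw [mul_comm (theta P δ) (Real.exp _), mul_assoc (Real.exp _) (theta P δ)]
  refine mul_le_mul_of_nonneg_left ?_ (Real.exp_pos _).le
  have h0 : 0 ≤ assignExp P w q (overflowInd m q) :=
    (assignExp_const hA.rule hA.samples_pos hA.samples_le 0 q).symm.le.trans
      (assignExp_le hA.rule hA.samples_pos fun _ _ => overflowInd_nonneg _ _ _)
  have h1 := mul_le_mul_of_nonneg_right hA.rate_mul_le h0
  have h1' : N * theta P δ * (1 - δ + δ / 16) * assignExp P w q (overflowInd m q) ≤
      N * theta P δ * 1 * assignExp P w q (overflowInd m q) := by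
    gcongr; linarith
  have h2 := le_one_sub_exp_neg hθ.le (by linarith)
  have h3 : theta P δ / 2 ≤ 1 - Real.exp (-theta P δ) := by nlinarith
  have h4 := mul_le_mul_of_nonneg_left h3 (Nat.cast_nonneg (α := ℝ) (longer m q))
  linarith

lemma delta_mul_excess_le (hA : Admissible N P w δ ε m) {q : Queues N}
    (hq : q ∈ states N P.cap) : δ * excess m q ≤ longer m q := by
  have h1 : (excess m q : ℝ) ≤ P.cap * longer m q := by
    exact_mod_cast excess_le m (le_cap_of_mem_states hq)
  have h2 := mul_le_mul_of_nonneg_left h1 hA.delta_pos.le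
  have h3 := mul_le_mul_of_nonneg_right hA.cap_le (Nat.cast_nonneg (α := ℝ) (longer m q))
  linarith

/-- The drift of the sum of two exponentials whose exponents are proportional to the total number
`t` of tasks and to the modified number `K` of tasks in long queues. -/
lemma exp_drift_le {N θ δ ε m t r e a l p K : ℝ} (hθ : 0 ≤ θ) (hδ : 0 < δ) (hNp : 0 < N)
    (hm : 0 < m) (hε : ε ≤ δ / 32) (hl0 : 0 ≤ l) (ha0 : 0 ≤ a) (hp1 : p ≤ 1)
    (hpε : N * (δ * m / 4) ≤ r → p ≤ ε) (htr : t + r = N * m + e) (hmr : m * N ≤ r + m * a)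
    (hle : δ * e ≤ l) (hK : K = (N * m - N * (δ * m / 2)) + e)
    (hE : Real.exp (-(θ * (N * (δ * m / 4)))) ≤ δ / 32) (hmax : N * (m + 1) ≤ max t K) :
    Real.exp (θ * t) * (N * (1 - δ + δ / 8) - a) + Real.exp (θ * K) * (N * p - l / 2) ≤
      -(N * (δ / 16) * Real.exp (θ * max t K)) := by
  have hNδ : 0 < N * δ := mul_pos hNp hδ
  have hNp1 : N * p ≤ N * 1 := mul_le_mul_of_nonneg_left hp1 hNp.le
  -- By `htr` and `hK`, K - t = r - Nδm/2. With little room, e^(θt) dominates, and so many servers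
  -- are busy that its drift is at most -5Nδ/8.
  rcases lt_or_ge r (N * (δ * m / 4)) with hC | hC
  · have hKt : K ≤ t - N * (δ * m / 4) := by rw [hK]; linarith
    have hKt' : K ≤ t := by
      have : 0 < N * (δ * m / 4) := by positivity
      linarith
    rw [max_eq_left hKt']
    have hm1 : N * (1 - δ / 4) ≤ a := by
      have : m * (N * (1 - δ / 4)) ≤ m * a := by linarith
      exact le_of_mul_le_mul_left this hm
    have h1 : Real.exp (θ * K) ≤ Real.exp (θ * t) * (δ / 32) := by
      calc _ ≤ Real.exp (θ * t + -(θ * (N * (δ * m / 4)))) := by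
            apply Real.exp_le_exp.2
            have := mul_le_mul_of_nonneg_left hKt hθ
            linarith
        _ ≤ _ := by rw [Real.exp_add]; gcongr
    have h2 : Real.exp (θ * K) * (N * p - l / 2) ≤ Real.exp (θ * t) * (δ / 32) * N := by
      calc _ ≤ Real.exp (θ * K) * N := by
            gcongr
            linarith
        _ ≤ _ := by gcongr
    have h3 : Real.exp (θ * t) * (N * (1 - δ + δ / 8) - a) ≤
        Real.exp (θ * t) * (-(5 * N * δ / 8)) := by
      gcongr
      linarith
    have h5 : 0 < Real.exp (θ * t) * (N * δ) := by positivity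
    linarith
  -- With enough room overflows are rare, so the second term can contribute a drift of at most
  -- Nδ/32.
  · have hpε := hpε hC
    have hNp' : N * p ≤ N * (δ / 32) := by gcongr; linarith
    rcases le_or_gt (N * (1 - 3 / 4 * δ)) a with hB | hB
    · have h3 : Real.exp (θ * t) * (N * (1 - δ + δ / 8) - a) ≤
          Real.exp (θ * t) * (-(N * δ / 8)) := by
        gcongr
        linarith
      rcases le_or_gt K t with hKt | hKt
      · rw [max_eq_left hKt]
        have h2 : Real.exp (θ * K) * (N * p - l / 2) ≤ Real.exp (θ * t) * (N * (δ / 32)) := by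
          calc _ ≤ Real.exp (θ * K) * (N * (δ / 32)) := by
                gcongr
                linarith
            _ ≤ _ := by gcongr
        have h5 : 0 < Real.exp (θ * t) * (N * δ) := by positivity
        linarith
      · rw [max_eq_right hKt.le] at hmax ⊢
        -- The level N(m+1) is reached by K, whose constant part is below Nm. So the excess is at
        -- least N, and at least δN queues are long.
        have heN : N ≤ e := by
          have : 0 < N * (δ * m / 2) := by positivity
          rw [hK] at hmax
          linarith
        have hlN : δ * N ≤ l := (mul_le_mul_of_nonneg_left heN hδ.le).trans hle
        have h2 : Real.exp (θ * K) * (N * p - l / 2) ≤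
            Real.exp (θ * K) * (-(N * δ / 4)) := by
          gcongr
          linarith [mul_pos hNp hδ]
        have h5 : 0 < Real.exp (θ * t) * (N * δ) := by positivity
        have h6 : 0 < Real.exp (θ * K) * (N * δ) := by positivity
        linarith
    -- Many idle servers mean much room. Then K exceeds t by Nδm/4, and the possibly positive drift
    -- of e^(θt) is negligible beside the negative one of e^(θK).
    · have hrB : N * (3 / 4 * δ * m) ≤ r := by
        have := mul_lt_mul_of_pos_left hB hm
        linarith
      have hKt : t + N * (δ * m / 4) ≤ K := by rw [hK]; linarith
      have hKt' : t ≤ K := by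
        have : 0 < N * (δ * m / 4) := by positivity
        linarith
      rw [max_eq_right hKt'] at hmax ⊢
      have heN : N ≤ e := by
        have : 0 < N * (δ * m / 2) := by positivity
        rw [hK] at hmax
        linarith
      have hlN : δ * N ≤ l := (mul_le_mul_of_nonneg_left heN hδ.le).trans hle
      have h2 : Real.exp (θ * K) * (N * p - l / 2) ≤
          Real.exp (θ * K) * (-(N * δ / 4)) := by
        gcongr
        linarith [mul_pos hNp hδ]
      have h1 : Real.exp (θ * t) ≤ Real.exp (θ * K) * (δ / 32) := by
        calc _ ≤ Real.exp (θ * K + -(θ * (N * (δ * m / 4)))) := by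
              apply Real.exp_le_exp.2
              have := mul_le_mul_of_nonneg_left hKt hθ
              linarith
          _ ≤ _ := by rw [Real.exp_add]; gcongr
      have h3 : Real.exp (θ * t) * (N * (1 - δ + δ / 8) - a) ≤
          Real.exp (θ * K) * (δ / 32) * N := by
        calc _ ≤ Real.exp (θ * t) * N := by
              gcongr
              linarith
          _ ≤ _ := by gcongr
      have h6 : 0 < Real.exp (θ * K) * (N * δ) := by positivity
      linarith

/-- Drift of the Lyapunov function. -/
lemma generator_lyapunov_le (hA : Admissible N P w δ ε m) {q : Queues N}
    (hq : q ∈ states N P.cap) :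
    generator P w (lyapunov N P δ m) q ≤
      theta P δ * N * (2 * Real.exp (theta P δ * (N * (m + 1))) -
        if N * (m + 2) ≤ total q then δ / 16 * Real.exp (theta P δ * (N * (m + 2))) else 0) := by
  have hθ := hA.theta_pos
  have hδ := hA.delta_pos
  have hδ1 := hA.delta_le
  have hk : (0 : ℝ) < P.tasks := by exact_mod_cast hA.tasks_pos
  have hNp : (0 : ℝ) < N := by exact_mod_cast hA.samples_pos.trans_le hA.samples_le
  have hm : (0 : ℝ) < m := by exact_mod_cast hA.m_pos
  have hε := hA.eps_le
  set θ := theta P δ with hθdef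
  set t : ℝ := (total q : ℝ) with ht
  set r : ℝ := (room m q : ℝ) with hr
  set e : ℝ := (excess m q : ℝ) with he
  set a : ℝ := (longer 0 q : ℝ) with ha
  set l : ℝ := (longer m q : ℝ) with hl
  set p : ℝ := assignExp P w q (overflowInd m q) with hp
  set K : ℝ := (N * m - N * (δ * m / 2)) + e with hK
  have hl0 : 0 ≤ l := Nat.cast_nonneg _
  have ha0 : 0 ≤ a := Nat.cast_nonneg _
  have hp1 : p ≤ 1 :=
    assignExp_overflow_le_one hA.rule hA.samples_pos hA.samples_le m q
  have hpε : N * (δ * m / 4) ≤ r → p ≤ ε := hA.overflow_le m le_rfl (by omega) q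
  have htr : t + r = N * m + e := by
    rw [ht, hr, he]; exact_mod_cast total_add_room m q
  have hmr : m * N ≤ r + m * a := by
    rw [hr, ha]; exact_mod_cast mul_le_room_add m q
  have hle : δ * e ≤ l := hA.delta_mul_excess_le hq
  have hgen : generator P w (lyapunov N P δ m) q ≤
      θ * (Real.exp (θ * t) * (N * (1 - δ + δ / 8) - a) + Real.exp (θ * K) * (N * p - l / 2)) := by
    have h1 := hA.generator_total_le q
    have h2 := hA.generator_excess_le (N * m - N * (δ * m / 2)) q
    have h3 := generator_add (P := P) (w := w) (fun q => Real.exp (θ * total q))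
      (fun q => Real.exp (θ * ((N * m - N * (δ * m / 2)) + excess m q))) q
    have h4 : generator P w (lyapunov N P δ m) q = _ := h3
    rw [h4, mul_add]
    refine (add_le_add h1 h2).trans (le_of_eq ?_)
    rw [← mul_assoc, ← mul_assoc]
  refine hgen.trans ?_
  rw [mul_assoc]
  refine mul_le_mul_of_nonneg_left ?_ hθ.le
  have hE : Real.exp (-(θ * (N * (δ * m / 4)))) ≤ δ / 32 := by
    have := hA.exp_le
    convert this using 3
    rw [hθdef, theta]; field_simp; ring
  have het := Real.exp_pos (θ * t)
  have heK := Real.exp_pos (θ * K)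
  have key := fun h => exp_drift_le hθ.le hδ hNp hm hε hl0 ha0 hp1 hpε htr hmr hle hK hE h
  have hNδ : 0 < N * δ := mul_pos hNp hδ
  have hNp1 : N * p ≤ N * 1 := mul_le_mul_of_nonneg_left hp1 hNp.le
  have hpos : 0 < N * (2 * Real.exp (θ * (N * (m + 1)))) := by positivity
  split_ifs with hT
  · have hT' : N * ((m : ℝ) + 2) ≤ t := by rw [ht]; exact_mod_cast hT
    have hmax : N * ((m : ℝ) + 2) ≤ max t K := hT'.trans (le_max_left _ _)
    refine (key (by linarith)).trans ?_
    have h1 : Real.exp (θ * (N * (m + 2))) ≤ Real.exp (θ * max t K) := by gcongr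
    have h2 : N * (δ / 16) * Real.exp (θ * (N * (m + 2))) ≤
        N * (δ / 16) * Real.exp (θ * max t K) := by gcongr
    linarith
  · rw [sub_zero]
    -- Below the level N(m+1) the drift may be positive, but each term contributes at most N
    -- e^(θN(m+1)).
    rcases le_or_gt (N * ((m : ℝ) + 1)) (max t K) with hmax | hmax
    · refine (key hmax).trans ?_
      have : 0 < N * (δ / 16) * Real.exp (θ * max t K) := by positivity
      linarith
    · obtain ⟨h1, h2⟩ := max_lt_iff.1 hmax
      have h3 : Real.exp (θ * t) * (N * (1 - δ + δ / 8) - a) ≤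
          Real.exp (θ * (N * (m + 1))) * N := by
        calc _ ≤ Real.exp (θ * t) * N := by
              gcongr
              linarith
          _ ≤ _ := by gcongr
      have h4 : Real.exp (θ * K) * (N * p - l / 2) ≤ Real.exp (θ * (N * (m + 1))) * N := by
        calc _ ≤ Real.exp (θ * K) * N := by
              gcongr
              linarith
          _ ≤ _ := by gcongr
      linarith

/-- In steady state a total of `N (m + 2)` tasks is exponentially unlikely. -/
lemma stationary_total_le (hA : Admissible N P w δ ε m) {pi : Queues N → ℝ}
    (hpi : IsStationary P w pi) :
    ∑ q ∈ states N P.cap, pi q * (if N * (m + 2) ≤ total q then 1 else 0) ≤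
      32 / δ * Real.exp (-(δ * N / (16 * P.tasks))) := by
  obtain ⟨h0, -, h1, h2⟩ := hpi
  have hθ := hA.theta_pos
  have hδ := hA.delta_pos
  have hNp : (0 : ℝ) < N := by exact_mod_cast hA.samples_pos.trans_le hA.samples_le
  set p := ∑ q ∈ states N P.cap, pi q * (if N * (m + 2) ≤ total q then (1 : ℝ) else 0) with hp
  set x := Real.exp (theta P δ * (N * (m + 1))) with hx
  set y := Real.exp (theta P δ * (N * (m + 2))) with hy
  -- The mean drift vanishes by stationarity, so the negative drift on the rare event is paid for by
  -- the bounded positive part.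
  have h3 : 0 ≤ theta P δ * N * (2 * x - δ / 16 * y * p) := by
    calc (0 : ℝ) = ∑ q ∈ states N P.cap, pi q * generator P w (lyapunov N P δ m) q := (h2 _).symm
      _ ≤ ∑ q ∈ states N P.cap, pi q * (theta P δ * N * (2 * x -
            if N * (m + 2) ≤ total q then δ / 16 * y else 0)) :=
          Finset.sum_le_sum fun q hq =>
            mul_le_mul_of_nonneg_left (hA.generator_lyapunov_le hq) (h0 q)
      _ = ∑ q ∈ states N P.cap, (theta P δ * N * (2 * x) * pi q -
            theta P δ * N * (δ / 16 * y) * (pi q *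
              if N * (m + 2) ≤ total q then 1 else 0)) :=
          Finset.sum_congr rfl fun q _ => by split_ifs <;> ring
      _ = _ := by
          rw [Finset.sum_sub_distrib, ← Finset.mul_sum, ← Finset.mul_sum, h1, ← hp]
          ring
  have h4 : 0 ≤ 2 * x - δ / 16 * y * p := nonneg_of_mul_nonneg_right h3 (by positivity)
  -- The gap N between the levels N(m+1) and N(m+2) yields the factor e^(-θN).
  have h5 : x = y * Real.exp (-(δ * N / (16 * P.tasks))) := by
    rw [hx, hy, ← Real.exp_add]
    congr 1
    have : δ * N / (16 * P.tasks) = theta P δ * N := by rw [theta]; ring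
    rw [this]; ring
  have hy0 : 0 < y := Real.exp_pos _
  rw [h5] at h4
  have h6 : δ / 16 * p ≤ 2 * Real.exp (-(δ * N / (16 * P.tasks))) := by
    have : y * (δ / 16 * p) ≤ y * (2 * Real.exp (-(δ * N / (16 * P.tasks)))) := by linarith
    exact le_of_mul_le_mul_left this hy0
  rw [div_mul_eq_mul_div, le_div_iff₀ hδ]
  linarith

end Admissible

end BatchFilling
end
noncomputable section
namespace BatchFilling

/-! ### Maxima of sums of independent exponential random variables -/

instance isProbabilityMeasure_expMeasure_one : IsProbabilityMeasure (expMeasure 1) :=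
  isProbabilityMeasure_expMeasure one_pos

lemma exponentialPDF_toReal_smul_exp (c : ℝ) :
    (fun x => (exponentialPDF 1 x).toReal • Real.exp (c * x)) =
      (Set.Ici (0 : ℝ)).indicator fun x => Real.exp ((c - 1) * x) := by
  funext x
  by_cases hx : 0 ≤ x
  · rw [Set.indicator_of_mem (by exact hx), exponentialPDF_of_nonneg hx,
      ENNReal.toReal_ofReal (by positivity), smul_eq_mul, one_mul, one_mul, ← Real.exp_add]
    ring_nf
  · rw [Set.indicator_of_notMem (by exact hx), exponentialPDF_of_neg (not_le.1 hx)]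
    simp

lemma measurable_exponentialPDF_one : Measurable (exponentialPDF 1) :=
  (measurable_exponentialPDFReal 1).ennreal_ofReal

lemma integrable_exp_mul_expMeasure {c : ℝ} (hc : c < 1) :
    Integrable (fun x => Real.exp (c * x)) (expMeasure 1) := by
  change Integrable _ (volume.withDensity (exponentialPDF 1))
  rw [integrable_withDensity_iff_integrable_smul' measurable_exponentialPDF_one
    (ae_of_all _ fun x => ENNReal.ofReal_lt_top), exponentialPDF_toReal_smul_exp,
    integrable_indicator_iff measurableSet_Ici, integrableOn_Ici_iff_integrableOn_Ioi]
  exact integrableOn_exp_mul_Ioi (by linarith) 0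

/-- Moment generating function of the exponential distribution. -/
lemma integral_exp_mul_expMeasure {c : ℝ} (hc : c < 1) :
    ∫ x, Real.exp (c * x) ∂(expMeasure 1) = (1 - c)⁻¹ := by
  change ∫ x, Real.exp (c * x) ∂(volume.withDensity (exponentialPDF 1)) = _
  rw [integral_withDensity_eq_integral_toReal_smul measurable_exponentialPDF_one
    (ae_of_all _ fun x => ENNReal.ofReal_lt_top), exponentialPDF_toReal_smul_exp,
    integral_indicator measurableSet_Ici, integral_Ici_eq_integral_Ioi,
    integral_exp_mul_Ioi (by linarith)]
  rw [mul_zero, Real.exp_zero, ← neg_sub 1 c, neg_div_neg_eq, one_div]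

lemma expMeasure_Iic {s : ℝ} (hs : 0 ≤ s) :
    expMeasure 1 (Set.Iic s) = ENNReal.ofReal (1 - Real.exp (-s)) := by
  have h := cdf_expMeasure_eq one_pos s
  rw [if_pos hs, one_mul, cdf_eq_real] at h
  rw [← h, ofReal_measureReal]

/-- Joint law of independent exponential random variables with rate `1`. -/
abbrev expLaw (κ : Type*) [Fintype κ] : Measure (κ → ℝ) := Measure.pi fun _ => expMeasure 1

lemma ae_nonneg_expLaw {κ : Type*} [Fintype κ] : ∀ᵐ x ∂expLaw κ, ∀ i, 0 ≤ x i := by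
  rw [ae_all_iff]
  intro i
  have h : ∀ᵐ y ∂(expMeasure 1), 0 ≤ y := by
    rw [ae_iff]
    refine measure_mono_null (t := Set.Iic 0) (fun y hy => (not_le.1 hy).le) ?_
    rw [expMeasure_Iic le_rfl]
    simp
  exact (Measure.quasiMeasurePreserving_eval _ i).ae h

lemma prod_ite_exp {κ : Type*} [Fintype κ] [DecidableEq κ]
    (S : Finset κ) (c : ℝ) (x : κ → ℝ) :
    ∏ i, (if i ∈ S then Real.exp (c * x i) else 1) = Real.exp (c * ∑ i ∈ S, x i) := by
  rw [Finset.prod_ite_mem, Finset.univ_inter, Finset.mul_sum, Real.exp_sum]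

lemma integrable_exp_mul_sum {κ : Type*} [Fintype κ] [DecidableEq κ]
    {c : ℝ} (hc : c < 1) (S : Finset κ) :
    Integrable (fun x : κ → ℝ => Real.exp (c * ∑ i ∈ S, x i)) (expLaw κ) := by
  have h : ∀ i, Integrable (fun y : ℝ => if i ∈ S then Real.exp (c * y) else 1)
      (expMeasure 1) := fun i => by
    by_cases hi : i ∈ S
    · simpa [hi] using integrable_exp_mul_expMeasure hc
    · simp [hi]
  have h2 := Integrable.fintype_prod (μ := fun _ : κ => expMeasure 1) h
  simpa only [prod_ite_exp] using h2

lemma integral_exp_mul_sum {κ : Type*} [Fintype κ] [DecidableEq κ]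
    {c : ℝ} (hc : c < 1) (S : Finset κ) :
    ∫ x : κ → ℝ, Real.exp (c * ∑ i ∈ S, x i) ∂(expLaw κ) = ((1 - c)⁻¹) ^ S.card := by
  have h := integral_fintype_prod_eq_prod (μ := fun _ : κ => expMeasure 1)
    (fun (i : κ) (y : ℝ) => if i ∈ S then Real.exp (c * y) else 1)
  simp only [prod_ite_exp] at h
  rw [h]
  have h2 : ∀ i, ∫ y : ℝ, (if i ∈ S then Real.exp (c * y) else 1) ∂(expMeasure 1) =
      if i ∈ S then (1 - c)⁻¹ else 1 := fun i => by
    by_cases hi : i ∈ S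
    · simpa [hi] using integral_exp_mul_expMeasure hc
    · simp [hi]
  simp only [h2]
  rw [Finset.prod_ite_mem, Finset.univ_inter, Finset.prod_const]

/-- For each sum u, apply 1 + y ≤ e^y with y = c(u - a), and bound its exponential by the sum of all
of them. This is a union bound without tail integration, with a left free for optimization. -/
lemma iSup_sum_le {κ ι : Type*} [Fintype ι]
    [Nonempty ι] {c : ℝ} (hc : 0 < c) (a : ℝ) (S : ι → Finset κ) (x : κ → ℝ) :
    ⨆ t, ∑ i ∈ S t, x i ≤
      a - 1 / c + Real.exp (-(c * a)) / c * ∑ t, Real.exp (c * ∑ i ∈ S t, x i) := by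
  refine ciSup_le fun t => ?_
  have h1 : Real.exp (c * ∑ i ∈ S t, x i) ≤ ∑ t, Real.exp (c * ∑ i ∈ S t, x i) :=
    Finset.single_le_sum (f := fun t => Real.exp (c * ∑ i ∈ S t, x i))
      (fun _ _ => (Real.exp_pos _).le) (Finset.mem_univ t)
  have h2 := Real.add_one_le_exp (-(c * a) + c * ∑ i ∈ S t, x i)
  rw [Real.exp_add] at h2
  have h3 := mul_le_mul_of_nonneg_left h1 (Real.exp_pos (-(c * a))).le
  rw [div_mul_eq_mul_div, ← sub_le_iff_le_add', le_div_iff₀ hc, sub_mul, sub_mul,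
    one_div_mul_cancel hc.ne']
  linarith

lemma ae_iSup_nonneg {κ ι : Type*} [Fintype κ]
    (S : ι → Finset κ) : 0 ≤ᵐ[expLaw κ] fun x => ⨆ t, ∑ i ∈ S t, x i := by
  filter_upwards [ae_nonneg_expLaw] with x hx
  exact Real.iSup_nonneg fun t => Finset.sum_nonneg fun i _ => hx i

lemma integrable_iSup {κ ι : Type*} [Fintype κ] [DecidableEq κ] [Fintype ι]
    [Nonempty ι] (S : ι → Finset κ) :
    Integrable (fun x => ⨆ t, ∑ i ∈ S t, x i) (expLaw κ) := by
  have hg : Integrable (fun x : κ → ℝ => (0 : ℝ) - 1 / (1 / 2) + Real.exp (-(1 / 2 * 0)) / (1 / 2) *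
      ∑ t, Real.exp (1 / 2 * ∑ i ∈ S t, x i)) (expLaw κ) :=
    (integrable_const _).add ((integrable_finsetSum _ fun t _ =>
      integrable_exp_mul_sum (by norm_num) (S t)).const_mul _)
  refine hg.mono' ?_ ?_
  · refine (Measurable.iSup fun t => ?_).aestronglyMeasurable
    exact Finset.measurable_sum _ fun i _ => measurable_pi_apply i
  · filter_upwards [ae_iSup_nonneg S] with x hx
    rw [Real.norm_of_nonneg hx]
    exact iSup_sum_le (by norm_num) 0 S x

/-- Upper bound for the mean of the maximum of `n` sums of at most `M` exponential variables. -/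
lemma integral_iSup_le {κ ι : Type*} [Fintype κ] [DecidableEq κ] [Fintype ι]
    [Nonempty ι] {η : ℝ} (h0 : 0 < η) (h1 : η < 1) {n M : ℕ}
    (hn : Fintype.card ι ≤ n) (S : ι → Finset κ) (hS : ∀ t, (S t).card ≤ M) :
    ∫ x, ⨆ t, ∑ i ∈ S t, x i ∂(expLaw κ) ≤ (Real.log n + M * Real.log η⁻¹) / (1 - η) := by
  set c := 1 - η with hc
  have hc0 : 0 < c := by rw [hc]; linarith
  have hn0 : (0 : ℝ) < n := by exact_mod_cast Fintype.card_pos.trans_le hn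
  set a := (Real.log n + M * Real.log η⁻¹) / c with ha
  have hint : Integrable (fun x : κ → ℝ => a - 1 / c + Real.exp (-(c * a)) / c *
      ∑ t, Real.exp (c * ∑ i ∈ S t, x i)) (expLaw κ) :=
    (integrable_const _).add ((integrable_finsetSum _ fun t _ =>
      integrable_exp_mul_sum (by rw [hc]; linarith) (S t)).const_mul _)
  refine (integral_mono (integrable_iSup S) hint fun x => iSup_sum_le hc0 a S x).trans ?_
  rw [integral_add (integrable_const _) ((integrable_finsetSum _ fun t _ =>
      integrable_exp_mul_sum (by rw [hc]; linarith) (S t)).const_mul _), integral_const,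
    integral_const_mul, integral_finsetSum _ fun t _ =>
      integrable_exp_mul_sum (by rw [hc]; linarith) (S t)]
  have hη : 1 ≤ η⁻¹ := (one_le_inv₀ h0).2 h1.le
  have hsum : ∑ t, ∫ x : κ → ℝ, Real.exp (c * ∑ i ∈ S t, x i) ∂(expLaw κ) ≤ n * η⁻¹ ^ M := by
    calc _ ≤ ∑ _t : ι, η⁻¹ ^ M := by
          refine Finset.sum_le_sum fun t _ => ?_
          rw [integral_exp_mul_sum (by rw [hc]; linarith), hc, sub_sub_cancel]
          exact pow_le_pow_right₀ hη (hS t)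
      _ = Fintype.card ι * η⁻¹ ^ M := by simp
      _ ≤ _ := by gcongr
  -- The choice of a makes the mean of the exponential term at most 1/c, which cancels -1/c.
  have hexp : Real.exp (-(c * a)) * (n * η⁻¹ ^ M) = 1 := by
    have : c * a = Real.log (n * η⁻¹ ^ M) := by
      rw [ha, mul_div_cancel₀ _ hc0.ne', Real.log_mul hn0.ne' (by positivity), Real.log_pow]
    rw [this, Real.exp_neg, Real.exp_log (by positivity), inv_mul_cancel₀ (by positivity)]
  have h3 : Real.exp (-(c * a)) / c * ∑ t, ∫ x : κ → ℝ, Real.exp (c * ∑ i ∈ S t, x i) ∂(expLaw κ) ≤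
      1 / c := by
    calc _ ≤ Real.exp (-(c * a)) / c * (n * η⁻¹ ^ M) := by gcongr
      _ = _ := by rw [div_mul_eq_mul_div, hexp]
  simp only [probReal_univ, one_smul]
  linarith

/-- Lower bound for the mean of the maximum of sums that contain distinct exponential variables. -/
lemma le_integral_iSup {κ ι : Type*} [Fintype κ] [DecidableEq κ] [Fintype ι]
    [Nonempty ι] {s : ℝ} (hs : 0 ≤ s) (S : ι → Finset κ) (e : ι → κ)
    (he : Function.Injective e) (heS : ∀ t, e t ∈ S t) :
    s * (1 - (1 - Real.exp (-s)) ^ Fintype.card ι) ≤ ∫ x, ⨆ t, ∑ i ∈ S t, x i ∂(expLaw κ) := by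
  classical
  -- The event that all the distinguished variables are at most s. It is a product set, so its
  -- probability factors, and off it the maximum is at least s.
  set B : Set (κ → ℝ) :=
    Set.pi Set.univ fun i => if i ∈ Finset.univ.image e then Set.Iic s else Set.univ with hB
  have hBm : MeasurableSet B := MeasurableSet.univ_pi fun i => by
    split_ifs
    · exact measurableSet_Iic
    · exact MeasurableSet.univ
  have hexp : 0 ≤ 1 - Real.exp (-s) := by
    have : Real.exp (-s) ≤ 1 := Real.exp_le_one_iff.2 (by linarith)
    linarith
  have hμB : (expLaw κ).real B = (1 - Real.exp (-s)) ^ Fintype.card ι := by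
    have h : ∀ i, expMeasure 1 (if i ∈ Finset.univ.image e then Set.Iic s else Set.univ) =
        if i ∈ Finset.univ.image e then ENNReal.ofReal (1 - Real.exp (-s)) else 1 := fun i => by
      split_ifs
      · exact expMeasure_Iic hs
      · exact measure_univ
    rw [measureReal_def, hB, Measure.pi_pi]
    simp only [h]
    rw [Finset.prod_ite_mem, Finset.univ_inter, Finset.prod_const,
      Finset.card_image_of_injective _ he, Finset.card_univ, ENNReal.toReal_pow,
      ENNReal.toReal_ofReal hexp]
  have h1 : ∫ x, Bᶜ.indicator (fun _ => s) x ∂(expLaw κ) =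
      s * (1 - (1 - Real.exp (-s)) ^ Fintype.card ι) := by
    rw [integral_indicator_const _ hBm.compl, probReal_compl_eq_one_sub hBm, hμB, smul_eq_mul,
      mul_comm]
  rw [← h1]
  refine integral_mono_ae ((integrable_const s).indicator hBm.compl) (integrable_iSup S) ?_
  filter_upwards [ae_nonneg_expLaw, ae_iSup_nonneg S] with x hx hsup
  by_cases hxB : x ∈ B
  · rw [Set.indicator_of_notMem (by simpa using hxB)]
    exact hsup
  · rw [Set.indicator_of_mem (by exact hxB)]
    simp only [hB, Set.mem_pi, Set.mem_univ, true_implies, not_forall] at hxB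
    obtain ⟨i, hi⟩ := hxB
    split_ifs at hi with him
    · obtain ⟨t, -, rfl⟩ := Finset.mem_image.1 him
      have h2 : s ≤ x (e t) := (not_le.1 hi).le
      have h3 : x (e t) ≤ ∑ i ∈ S t, x i :=
        Finset.single_le_sum (fun i _ => hx i) (heS t)
      exact (h2.trans h3).trans
        (le_ciSup (f := fun t => ∑ i ∈ S t, x i) (Set.finite_range _).bddAbove t)
    · exact absurd (Set.mem_univ _) hi

/-- With singletons as index sets, the bounds for job delays also apply to the inherent delay. -/
lemma meanInherentDelay_eq (k : ℕ) :
    meanInherentDelay k = ∫ x, ⨆ t : Fin k, ∑ i ∈ ({t} : Finset (Fin k)), x i ∂(expLaw (Fin k)) := by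
  simp [meanInherentDelay]

lemma meanInherentDelay_le {η : ℝ} (h0 : 0 < η) (h1 : η < 1) {k : ℕ} (hk : 0 < k) :
    meanInherentDelay k ≤ (Real.log k + Real.log η⁻¹) / (1 - η) := by
  have : Nonempty (Fin k) := ⟨⟨0, hk⟩⟩
  rw [meanInherentDelay_eq]
  refine (integral_iSup_le h0 h1 (n := k) (M := 1) (by simp) _ (by simp)).trans (le_of_eq ?_)
  simp

lemma le_meanInherentDelay {s : ℝ} (hs : 0 ≤ s) {k : ℕ} (hk : 0 < k) :
    s * (1 - (1 - Real.exp (-s)) ^ k) ≤ meanInherentDelay k := by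
  have : Nonempty (Fin k) := ⟨⟨0, hk⟩⟩
  rw [meanInherentDelay_eq]
  simpa using le_integral_iSup hs (fun t : Fin k => ({t} : Finset (Fin k))) id
    Function.injective_id (by simp)

/-! ### The delay of a job -/

variable {N cap : ℕ}

/-- The tasks of a job that changes the queue lengths from `q` to `q'`. -/
abbrev JobTask (q q' : Queues N) := {t : (j : Fin N) × Fin (q' j + 1) // q t.1 < (t.2 : ℕ)}

lemma card_jobTask {k : ℕ} {q q' : Queues N} (h : Added k q q') :
    Fintype.card (JobTask q q') = k := by
  let e : JobTask q q' ≃ (j : Fin N) × Fin (q' j - q j) :=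
    { toFun := fun t => ⟨t.1.1, ⟨t.1.2 - q t.1.1 - 1, by have := t.2; have := t.1.2.2; omega⟩⟩
      invFun := fun t => ⟨⟨t.1, ⟨t.2 + q t.1 + 1, by have := t.2.2; omega⟩⟩, by simp only; omega⟩
      left_inv := by
        rintro ⟨⟨j, p, hp⟩, hj⟩
        simp only [Subtype.mk.injEq, Sigma.mk.injEq, heq_eq_eq, true_and, Fin.mk.injEq]
        simp only at hj
        omega
      right_inv := by
        rintro ⟨j, p, hp⟩
        simp only [Sigma.mk.injEq, heq_eq_eq, true_and, Fin.mk.injEq]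
        omega }
  rw [Fintype.card_congr e]
  simp only [Fintype.card_sigma, Fintype.card_fin]
  have h2 : ∑ j, (q' j - q j) + ∑ j, q j = ∑ j, q' j := by
    rw [← Finset.sum_add_distrib]
    exact Finset.sum_congr rfl fun j _ => Nat.sub_add_cancel (h.1 j)
  have h3 := h.2
  simp only [total] at h3
  omega

/-- The service times that make up the completion time of the task at position `p` of queue `j`. -/
def servedBefore (cap : ℕ) (j : Fin N) (p : ℕ) : Finset (Fin N × Fin cap) :=
  ((Finset.univ : Finset (Fin cap)).filter fun i => i.val < p).map ⟨fun i => (j, i), fun a b h => by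
    simpa using h⟩

lemma completionTime_eq (x : Fin N × Fin cap → ℝ) (j : Fin N) (p : ℕ) :
    completionTime x j p = ∑ i ∈ servedBefore cap j p, x i := by
  simp only [completionTime, servedBefore, Finset.sum_map]
  rfl

lemma card_servedBefore_le (j : Fin N) (p : ℕ) : (servedBefore cap j p).card ≤ p := by
  rw [servedBefore, Finset.card_map]
  calc _ = (((Finset.univ : Finset (Fin cap)).filter fun i => i.val < p).map
        Fin.valEmbedding).card := (Finset.card_map _).symm
    _ ≤ (Finset.range p).card := by
        refine Finset.card_le_card fun i hi => ?_
        obtain ⟨a, ha, rfl⟩ := Finset.mem_map.1 hi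
        simpa using (Finset.mem_filter.1 ha).2
    _ = p := Finset.card_range p

lemma nonempty_jobTask {k : ℕ} (hk : 0 < k) {q q' : Queues N} (h : Added k q q') :
    Nonempty (JobTask q q') := by
  rw [← Fintype.card_pos_iff, card_jobTask h]
  exact hk

lemma integral_jobDelay_eq (q q' : Queues N) :
    ∫ x, jobDelay q q' x ∂(serviceLaw N cap) =
      ∫ x, ⨆ t : JobTask q q', ∑ i ∈ servedBefore cap t.1.1 t.1.2, x i
        ∂(expLaw (Fin N × Fin cap)) := by
  simp only [jobDelay, completionTime_eq]
  rfl

lemma integral_jobDelay_le {η : ℝ} (h0 : 0 < η) (h1 : η < 1) {k M : ℕ} (hk : 0 < k)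
    {q q' : Queues N} (h : Added k q q') (hM : ∀ t : JobTask q q', (t.1.2 : ℕ) ≤ M) :
    ∫ x, jobDelay q q' x ∂(serviceLaw N cap) ≤
      (Real.log k + M * Real.log η⁻¹) / (1 - η) := by
  have := nonempty_jobTask hk h
  rw [integral_jobDelay_eq]
  exact integral_iSup_le h0 h1 (card_jobTask h).le _ fun t => (card_servedBefore_le _ _).trans (hM t)

lemma le_integral_jobDelay {s : ℝ} (hs : 0 ≤ s) {k : ℕ} (hk : 0 < k)
    {q q' : Queues N} (h : Added k q q') (hcap : Admitted cap q') :
    s * (1 - (1 - Real.exp (-s)) ^ k) ≤ ∫ x, jobDelay q q' x ∂(serviceLaw N cap) := by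
  have := nonempty_jobTask hk h
  rw [integral_jobDelay_eq]
  have hpos : ∀ t : JobTask q q', (t.1.2 : ℕ) - 1 < cap := fun t => by
    have h1 := t.2
    have h2 := t.1.2.2
    have h3 := hcap t.1.1
    omega
  -- The distinguished variable of a task is its own service time. Positions start at 1 and indices
  -- at 0, hence the index p - 1, which is below `cap` for an admitted job.
  have := le_integral_iSup hs
    (fun t : JobTask q q' => servedBefore cap t.1.1 t.1.2)
    (fun t => (t.1.1, ⟨(t.1.2 : ℕ) - 1, hpos t⟩)) ?_ ?_
  · rwa [card_jobTask h] at this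
  · rintro ⟨⟨j, p, hp⟩, hj⟩ ⟨⟨j', p', hp'⟩, hj'⟩ heq
    simp only [Prod.mk.injEq, Fin.mk.injEq] at heq
    obtain ⟨rfl, h2⟩ := heq
    simp only at hj hj'
    obtain rfl : p = p' := by omega
    rfl
  · intro t
    have := t.2
    simp only [servedBefore, Finset.mem_map, Finset.mem_filter, Finset.mem_univ, true_and]
    exact ⟨⟨(t.1.2 : ℕ) - 1, hpos t⟩, by simp only; omega, rfl⟩

end BatchFilling
end
noncomputable section
namespace BatchFilling

/-! ### Jobs arriving in steady state -/

variable {N : ℕ} {w : Queues N → Finset (Fin N) → Fin N → ℝ} {P : Params} {pi : Queues N → ℝ}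

lemma arrivalExp_le (hw : IsShortestQueueRule w) (hs : 0 < P.samples) (h0 : ∀ q, 0 ≤ pi q)
    {F G : Queues N → Queues N → ℝ}
    (hFG : ∀ q ∈ states N P.cap, ∀ q', Added P.tasks q q' → F q q' ≤ G q q') :
    arrivalExp P w pi F ≤ arrivalExp P w pi G :=
  Finset.sum_le_sum fun q hq =>
    mul_le_mul_of_nonneg_left (assignExp_le hw hs (hFG q hq)) (h0 q)

lemma arrivalExp_add (F G : Queues N → Queues N → ℝ) :
    arrivalExp P w pi (fun q q' => F q q' + G q q') =
      arrivalExp P w pi F + arrivalExp P w pi G := by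
  simp only [arrivalExp, assignExp_add, mul_add, Finset.sum_add_distrib]

lemma arrivalExp_const_mul (c : ℝ) (F : Queues N → Queues N → ℝ) :
    arrivalExp P w pi (fun q q' => c * F q q') = c * arrivalExp P w pi F := by
  simp only [arrivalExp, assignExp_const_mul, Finset.mul_sum]
  exact Finset.sum_congr rfl fun q _ => by ring

lemma arrivalExp_const (hw : IsShortestQueueRule w) (hs : 0 < P.samples) (hN : P.samples ≤ N)
    (hpi : IsStationary P w pi) (c : ℝ) : arrivalExp P w pi (fun _ _ => c) = c := by
  simp only [arrivalExp, assignExp_const hw hs hN]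
  rw [← Finset.sum_mul, hpi.2.2.1, one_mul]

open Classical in
/-- Probability that a job arriving in steady state is admitted. -/
def acceptProb (P : Params) (w : Queues N → Finset (Fin N) → Fin N → ℝ) (pi : Queues N → ℝ) : ℝ :=
  arrivalExp P w pi fun _ q' => if Admitted P.cap q' then 1 else 0

lemma acceptProb_eq (hw : IsShortestQueueRule w) (hs : 0 < P.samples) (hN : P.samples ≤ N)
    (hpi : IsStationary P w pi) : acceptProb P w pi = 1 - dropProb P w pi := by
  rw [eq_sub_iff_add_eq, acceptProb, dropProb, ← arrivalExp_add]
  refine Eq.trans ?_ (arrivalExp_const hw hs hN hpi 1)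
  congr 1
  funext q q'
  split_ifs <;> norm_num

namespace Admissible

variable {δ ε : ℝ} {m : ℕ}

/-- Probability that some task of a job that arrives in steady state is put at a position beyond
`m + 3`. -/
lemma overflowProb_le (hA : Admissible N P w δ ε m) (hpi : IsStationary P w pi) (hε : 0 ≤ ε)
    (hδm : δ * m / 4 ≤ 1) :
    arrivalExp P w pi (overflowInd (m + 3)) ≤
      32 / δ * Real.exp (-(δ * N / (16 * P.tasks))) + ε := by
  have h1 := hA.stationary_total_le hpi
  calc arrivalExp P w pi (overflowInd (m + 3))
      ≤ ∑ q ∈ states N P.cap, (pi q * (if N * (m + 2) ≤ total q then 1 else 0) + pi q * ε) := by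
        refine Finset.sum_le_sum fun q _ => ?_
        rw [← mul_add]
        refine mul_le_mul_of_nonneg_left ?_ (hpi.1 q)
        split_ifs with h
        · have := assignExp_overflow_le_one hA.rule hA.samples_pos hA.samples_le (m + 3) q
          linarith
        · rw [zero_add]
          refine hA.overflow_le (m + 3) (by omega) le_rfl q ?_
          -- Fewer than N(m+2) tasks leave at least N of the N(m+3) places up to m+3 free, which is
          -- more than the required Nδm/4.
          have h2 := total_add_room (m + 3) q
          have h3 : N ≤ room (m + 3) q := by nlinarith
          have h4 : (N : ℝ) ≤ room (m + 3) q := by exact_mod_cast h3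
          calc N * (δ * m / 4) ≤ N * 1 := by gcongr
            _ ≤ _ := by rwa [mul_one]
    _ = ∑ q ∈ states N P.cap, pi q * (if N * (m + 2) ≤ total q then 1 else 0) + ε := by
        rw [Finset.sum_add_distrib, ← Finset.sum_mul, hpi.2.2.1, one_mul]
    _ ≤ _ := by linarith

/-- A dropped job has a task beyond the buffer capacity, hence beyond both m+3 and the old length of
that queue. -/
lemma dropProb_le (hA : Admissible N P w δ ε m) (hpi : IsStationary P w pi)
    (hcap : m + 3 ≤ P.cap) : dropProb P w pi ≤ arrivalExp P w pi (overflowInd (m + 3)) := by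
  refine arrivalExp_le hA.rule hA.samples_pos hpi.1 fun q hq q' _ => ?_
  split_ifs with h
  · exact overflowInd_nonneg _ _ _
  · have : Overflow (m + 3) q q' := by
      simp only [Admitted, not_forall, not_le] at h
      obtain ⟨j, hj⟩ := h
      exact ⟨j, (max_le (le_cap_of_mem_states hq j) hcap).trans_lt hj⟩
    simp [overflowInd, this]

lemma le_meanDelayAdmitted (hA : Admissible N P w δ ε m) (hpi : IsStationary P w pi)
    (hdrop : dropProb P w pi < 1) {s : ℝ} (hs : 0 ≤ s) :
    s * (1 - (1 - Real.exp (-s)) ^ P.tasks) ≤ meanDelayAdmitted P w pi := by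
  have hp := acceptProb_eq hA.rule hA.samples_pos hA.samples_le hpi
  have hpos : 0 < acceptProb P w pi := by rw [hp]; linarith
  change _ ≤ _ / acceptProb P w pi
  rw [le_div_iff₀ hpos, acceptProb, ← arrivalExp_const_mul]
  refine arrivalExp_le hA.rule hA.samples_pos hpi.1 fun q _ q' hq' => ?_
  split_ifs with h
  · rw [mul_one]
    exact le_integral_jobDelay hs hA.tasks_pos hq' h
  · rw [mul_zero]

/-- Without overflow the tasks are at positions at most m+3, and η remains free. With overflow only
`cap` bounds the positions, and the crude choice η = 1/2 suffices because of the factor γ. The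
admission probability is at least 1 - γ. -/
lemma meanDelayAdmitted_le (hA : Admissible N P w δ ε m) (hpi : IsStationary P w pi)
    (hcap : m + 3 ≤ P.cap) {γ : ℝ} (hγ : arrivalExp P w pi (overflowInd (m + 3)) ≤ γ)
    (hγ1 : γ < 1) {η : ℝ} (h0 : 0 < η) (h1 : η < 1) :
    meanDelayAdmitted P w pi ≤
      ((Real.log P.tasks + (m + 3 : ℕ) * Real.log η⁻¹) / (1 - η) +
        γ * ((Real.log P.tasks + P.cap * Real.log (1 / 2)⁻¹) / (1 - 1 / 2))) / (1 - γ) := by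
  have hp := acceptProb_eq hA.rule hA.samples_pos hA.samples_le hpi
  have hd := hA.dropProb_le hpi hcap
  have hk : 0 ≤ Real.log P.tasks := Real.log_natCast_nonneg _
  have hη : 0 ≤ Real.log η⁻¹ := Real.log_nonneg ((one_le_inv₀ h0).2 h1.le)
  have h2 : 0 ≤ Real.log (1 / 2 : ℝ)⁻¹ := Real.log_nonneg (by norm_num)
  set B := (Real.log P.tasks + (m + 3 : ℕ) * Real.log η⁻¹) / (1 - η) with hB
  set D := (Real.log P.tasks + P.cap * Real.log (1 / 2)⁻¹) / (1 - 1 / 2) with hD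
  have hB0 : 0 ≤ B := div_nonneg (by positivity) (by linarith)
  have hD0 : 0 ≤ D := div_nonneg (by positivity) (by norm_num)
  have hle : (1 - γ) ≤ acceptProb P w pi := by rw [hp]; linarith
  have hγ0 : 0 ≤ γ := by
    refine le_trans ?_ hγ
    rw [← arrivalExp_const hA.rule hA.samples_pos hA.samples_le hpi 0]
    exact arrivalExp_le hA.rule hA.samples_pos hpi.1 fun q _ q' _ => overflowInd_nonneg _ _ _
  change _ / acceptProb P w pi ≤ _
  refine div_le_div₀ (by positivity) ?_ (by linarith) hle
  calc _ ≤ arrivalExp P w pi (fun q q' => B + D * overflowInd (m + 3) q q') := by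
        refine arrivalExp_le hA.rule hA.samples_pos hpi.1 fun q _ q' hq' => ?_
        have h4 := overflowInd_nonneg (m + 3) q q'
        split_ifs with h
        · by_cases ho : Overflow (m + 3) q q'
          · have : ∫ x, jobDelay q q' x ∂(serviceLaw N P.cap) ≤ D :=
              integral_jobDelay_le (by norm_num) (by norm_num) hA.tasks_pos hq' fun t => by
                have := t.1.2.2
                have := h t.1.1
                omega
            simp only [overflowInd, ho, if_true]
            linarith
          · have : ∫ x, jobDelay q q' x ∂(serviceLaw N P.cap) ≤ B :=
              integral_jobDelay_le h0 h1 hA.tasks_pos hq' fun t => by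
                have h5 := t.1.2.2
                have h6 := t.2
                have h7 : ¬ max (q t.1.1) (m + 3) < q' t.1.1 := fun h => ho ⟨_, h⟩
                omega
            simp only [overflowInd, ho, if_false]
            linarith
        · positivity
    _ = B + D * arrivalExp P w pi (overflowInd (m + 3)) := by
        rw [arrivalExp_add, arrivalExp_const hA.rule hA.samples_pos hA.samples_le hpi,
          arrivalExp_const_mul]
    _ ≤ B + D * γ := by gcongr
    _ = _ := by ring

end Admissible

end BatchFilling
end
noncomputable section
namespace BatchFilling

/-! ### Large systems -/

/-- The inequalities that hold for all sufficiently large systems. -/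
structure LargeSystem (α β : ℝ) (k : ℕ) (d : ℝ) (N m : ℕ) : Prop where
  alpha_pos : 0 < α
  alpha_lt : α < 1 / 2
  beta_pos : 0 < β
  beta_le : β ≤ 1
  le_log : 256 ≤ β ^ 2 * Real.log N
  log_le : Real.log N ≤ (N : ℝ) ^ α
  tasks_pos : 0 < k
  tasks_le : k * Real.log N ^ 2 ≤ (N : ℝ) ^ ((1 : ℝ) / 2 - α)
  -- This makes the Chernoff bound e^(-k/(5M)) at most N^(-4) for all M ≤ m+3.
  le_tasks : 20 * Real.log N * (m + 3) ≤ k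
  m_pos : 0 < m
  m_le : m + 3 ≤ Real.log N
  le_overhead : 8 / (β * (N : ℝ) ^ (-α) * m) ≤ d

/-! ### Consequences of the inequalities for a fixed large N -/

namespace LargeSystem

variable {α β d : ℝ} {k N m : ℕ}

lemma log_ge (h : LargeSystem α β k d N m) : 256 ≤ Real.log N := by
  have h1 := h.le_log
  have h2 : β ^ 2 ≤ 1 := pow_le_one₀ h.beta_pos.le h.beta_le
  by_contra hlt
  have h3 : 0 < Real.log N := by
    by_contra h4
    have : β ^ 2 * Real.log N ≤ 0 := mul_nonpos_of_nonneg_of_nonpos (by positivity) (not_lt.1 h4)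
    linarith
  nlinarith

lemma N_pos (h : LargeSystem α β k d N m) : (0 : ℝ) < N := by
  have h1 := h.log_ge
  rcases Nat.eq_zero_or_pos N with rfl | h2
  · simp at h1
    linarith
  · exact_mod_cast h2

lemma log_le_N (h : LargeSystem α β k d N m) : Real.log N ≤ N := by
  have := Real.log_le_sub_one_of_pos h.N_pos
  linarith

lemma one_le_N (h : LargeSystem α β k d N m) : (1 : ℝ) ≤ N := by
  have := h.log_ge
  have := h.log_le_N
  linarith

lemma N_ge (h : LargeSystem α β k d N m) : (256 : ℝ) ≤ N := h.log_ge.trans h.log_le_N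

lemma one_le_rpow_alpha (h : LargeSystem α β k d N m) : 1 ≤ (N : ℝ) ^ α :=
  Real.one_le_rpow h.one_le_N h.alpha_pos.le

lemma one_le_rpow_sub (h : LargeSystem α β k d N m) : 1 ≤ (N : ℝ) ^ ((1 : ℝ) / 2 - α) :=
  Real.one_le_rpow h.one_le_N (by linarith [h.alpha_lt])

lemma rpow_alpha_le (h : LargeSystem α β k d N m) : (N : ℝ) ^ α ≤ Real.sqrt N := by
  rw [Real.sqrt_eq_rpow]
  exact Real.rpow_le_rpow_of_exponent_le h.one_le_N h.alpha_lt.le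

lemma sqrt_le_N (h : LargeSystem α β k d N m) : Real.sqrt N ≤ N := by
  rw [Real.sqrt_le_left h.N_pos.le]
  nlinarith [h.one_le_N]

lemma N_eq (h : LargeSystem α β k d N m) :
    (N : ℝ) = ((N : ℝ) ^ α) ^ 2 * ((N : ℝ) ^ ((1 : ℝ) / 2 - α)) ^ 2 := by
  rw [← mul_pow, ← Real.rpow_add h.N_pos]
  rw [add_sub_cancel, ← Real.sqrt_eq_rpow, Real.sq_sqrt h.N_pos.le]

lemma delta_eq (h : LargeSystem α β k d N m) : β * (N : ℝ) ^ (-α) = β / (N : ℝ) ^ α := by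
  rw [Real.rpow_neg h.N_pos.le, div_eq_mul_inv]

lemma delta_pos (h : LargeSystem α β k d N m) : 0 < β * (N : ℝ) ^ (-α) :=
  mul_pos h.beta_pos (Real.rpow_pos_of_pos h.N_pos _)

lemma delta_le (h : LargeSystem α β k d N m) : β * (N : ℝ) ^ (-α) ≤ 1 := by
  rw [h.delta_eq, div_le_one (by linarith [h.one_le_rpow_alpha])]
  exact h.beta_le.trans h.one_le_rpow_alpha

lemma le_delta (h : LargeSystem α β k d N m) : 256 / (N : ℝ) ^ 2 ≤ β * (N : ℝ) ^ (-α) := by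
  have hx := h.one_le_rpow_alpha
  have hxN : (N : ℝ) ^ α ≤ N := h.rpow_alpha_le.trans h.sqrt_le_N
  have hN := h.N_pos
  have h1 : 256 ≤ β * N := by
    calc 256 ≤ β ^ 2 * Real.log N := h.le_log
      _ ≤ β * N := by
        have h2 : β ^ 2 ≤ β := by nlinarith [h.beta_pos, h.beta_le]
        have := h.log_le_N
        have := h.log_ge
        have := h.beta_pos
        gcongr
  rw [h.delta_eq, div_le_div_iff₀ (by positivity) (by linarith)]
  calc 256 * (N : ℝ) ^ α ≤ (β * N) * N := by gcongr
    _ = _ := by ring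

/-- Here δ²N = β² (N^(1/2-α))², whereas k log² N is at most N^(1/2-α). So δ²N/k and δN/k are at
least 256 log N, which makes the exponential estimates polynomially small in N. -/
lemma tasks_log_le (h : LargeSystem α β k d N m) :
    256 * Real.log N * k ≤ (β * (N : ℝ) ^ (-α)) ^ 2 * N := by
  set x := (N : ℝ) ^ α with hx
  set y := (N : ℝ) ^ ((1 : ℝ) / 2 - α) with hy
  have hx1 : 1 ≤ x := h.one_le_rpow_alpha
  have hy1 : 1 ≤ y := h.one_le_rpow_sub
  have hL := h.log_ge
  have hk : (0 : ℝ) < k := by exact_mod_cast h.tasks_pos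
  have h1 : (β * (N : ℝ) ^ (-α)) ^ 2 * N = β ^ 2 * y ^ 2 := by
    rw [h.delta_eq, ← hx]
    nth_rewrite 1 [h.N_eq]
    rw [← hx, ← hy]
    field_simp
  rw [h1]
  calc 256 * Real.log N * k ≤ (β ^ 2 * Real.log N) * Real.log N * k := by
        have := h.le_log
        gcongr
    _ = β ^ 2 * (k * Real.log N ^ 2) := by ring
    _ ≤ β ^ 2 * y := by
        have := h.tasks_le
        gcongr
    _ ≤ β ^ 2 * y ^ 2 := by
        gcongr
        nlinarith

lemma exp_neg_four_log (h : LargeSystem α β k d N m) :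
    Real.exp (-(4 * Real.log N)) = 1 / (N : ℝ) ^ 4 := by
  have : 4 * Real.log N = Real.log ((N : ℝ) ^ 4) := by rw [Real.log_pow]; norm_num
  rw [this, Real.exp_neg, Real.exp_log (pow_pos h.N_pos 4), one_div]

lemma inv_pow_four_le (h : LargeSystem α β k d N m) :
    1 / (N : ℝ) ^ 4 ≤ β * (N : ℝ) ^ (-α) / 32 := by
  have hN := h.N_pos
  have h1 := h.le_delta
  have h2 : 1 / (N : ℝ) ^ 4 ≤ 1 / (N : ℝ) ^ 2 :=
    one_div_le_one_div_of_le (by positivity) (pow_le_pow_right₀ h.one_le_N (by norm_num))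
  have h3 : 256 / (N : ℝ) ^ 2 = 256 * (1 / (N : ℝ) ^ 2) := by ring
  have h4 : 0 < 1 / (N : ℝ) ^ 2 := by positivity
  linarith

/-- If kd is at most N up to rounding, the overhead gives kd · δm/4 ≥ 2k, and the slack k/10 absorbs
the floor. If all N queues are sampled, `tasks_log_le` gives Nδm/4 ≥ 64k. -/
lemma le_samples_mul (h : LargeSystem α β k d N m) :
    19 / 10 * (k : ℝ) ≤ (params α β k d N).samples * (β * (N : ℝ) ^ (-α) * m / 4) := by
  have hδ := h.delta_pos
  have hδ1 := h.delta_le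
  have hk : (0 : ℝ) < k := by exact_mod_cast h.tasks_pos
  have hm : (1 : ℝ) ≤ m := by exact_mod_cast h.m_pos
  have hL := h.log_ge
  have h1 := h.tasks_log_le
  have h2 := h.le_tasks
  have h3 := h.le_overhead
  set δ := β * (N : ℝ) ^ (-α) with hδdef
  have hmk : 80 * (m : ℝ) ≤ k := by nlinarith
  simp only [params, Nat.cast_min]
  rcases le_total ((⌊(k : ℝ) * d⌋₊ : ℕ) : ℝ) (N : ℝ) with hle | hle
  · rw [min_eq_left hle]
    have h4 := (Nat.lt_floor_add_one ((k : ℝ) * d)).le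
    have h5 : 8 ≤ d * (δ * m) := by rwa [div_le_iff₀ (by positivity)] at h3
    have h6 := mul_le_mul_of_nonneg_right h4 (show 0 ≤ δ * m / 4 by positivity)
    have h7 := mul_le_mul_of_nonneg_left h5 hk.le
    have h8 : δ * m ≤ 1 * m := by gcongr
    linarith
  · rw [min_eq_right hle]
    have h4 : δ ^ 2 * N ≤ δ * N := by
      have : δ ^ 2 ≤ δ := by nlinarith
      gcongr
    have h5 : 256 * (k : ℝ) ≤ 256 * Real.log N * k := by nlinarith
    have h6 : N * δ ≤ N * δ * m := le_mul_of_one_le_right (by positivity) hm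
    linarith

lemma admissible (h : LargeSystem α β k d N m)
    {w : Queues N → Finset (Fin N) → Fin N → ℝ} (hw : IsShortestQueueRule w) :
    Admissible N (params α β k d N) w (β * (N : ℝ) ^ (-α)) (1 / (N : ℝ) ^ 4) m := by
  have hδ := h.delta_pos
  have hδ1 := h.delta_le
  have hk : (0 : ℝ) < k := by exact_mod_cast h.tasks_pos
  have hm : (1 : ℝ) ≤ m := by exact_mod_cast h.m_pos
  have hL := h.log_ge
  have hsam := h.le_samples_mul
  have hs : 0 < (params α β k d N).samples := by
    rcases Nat.eq_zero_or_pos (params α β k d N).samples with h0 | h0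
    · rw [h0, Nat.cast_zero, zero_mul] at hsam
      linarith
    · exact h0
  have hsN : (params α β k d N).samples ≤ N := min_le_right _ _
  refine ⟨hw, hs, hsN, h.tasks_pos, ?_, hδ, hδ1, h.m_pos, ?_, h.inv_pow_four_le, ?_, ?_⟩
  · rfl
  · have hx := h.one_le_rpow_alpha
    have hb : 0 ≤ buffer α k N := le_min (by positivity) (by positivity)
    have h1 : ((params α β k d N).cap : ℝ) ≤ (N : ℝ) ^ α :=
      (Nat.floor_le hb).trans (min_le_left _ _)
    calc _ ≤ (N : ℝ) ^ α * (β * (N : ℝ) ^ (-α)) := by gcongr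
      _ = β := by rw [h.delta_eq]; field_simp
      _ ≤ 1 := h.beta_le
  · intro M hM1 hM2 q hq
    have hM : 0 < M := h.m_pos.trans_le hM1
    refine (assignExp_overflow_le hw hs hsN hM ?_).trans ?_
    · change 19 / 10 * (k : ℝ) * N ≤ _
      have h1 := mul_le_mul_of_nonneg_left hq
        (Nat.cast_nonneg (α := ℝ) (params α β k d N).samples)
      have h2 := mul_le_mul_of_nonneg_right hsam h.N_pos.le
      linarith
    · rw [← h.exp_neg_four_log]
      apply Real.exp_le_exp.2
      have hM0 : (0 : ℝ) < M := by exact_mod_cast hM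
      have hM3 : (M : ℝ) ≤ m + 3 := by exact_mod_cast hM2
      have h2 := h.le_tasks
      rw [neg_le_neg_iff]
      change _ ≤ (k : ℝ) / _
      rw [le_div_iff₀ (by positivity)]
      have h3 : 20 * Real.log N * M ≤ 20 * Real.log N * (m + 3) := by gcongr
      linarith
  · refine le_trans ?_ h.inv_pow_four_le
    rw [← h.exp_neg_four_log]
    apply Real.exp_le_exp.2
    rw [neg_le_neg_iff]
    change _ ≤ _ / (64 * (k : ℝ))
    rw [le_div_iff₀ (by positivity)]
    have h1 := h.tasks_log_le
    have h2 : (β * (N : ℝ) ^ (-α)) ^ 2 * N ≤ (β * (N : ℝ) ^ (-α)) ^ 2 * N * m :=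
      le_mul_of_one_le_right (by have := h.N_pos; positivity) hm
    linarith

lemma cap_ge (h : LargeSystem α β k d N m) : m + 3 ≤ (params α β k d N).cap := by
  have hk : (0 : ℝ) < k := by exact_mod_cast h.tasks_pos
  have hL := h.log_ge
  refine Nat.le_floor ?_
  push_cast
  refine h.m_le.trans (le_min h.log_le ?_)
  rw [le_div_iff₀ hk]
  refine le_trans ?_ h.tasks_le
  rw [mul_comm]
  gcongr
  nlinarith

lemma buffer_pos (h : LargeSystem α β k d N m) : 0 < buffer α k N := by
  have hk : (0 : ℝ) < k := by exact_mod_cast h.tasks_pos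
  have := h.one_le_rpow_alpha
  have := h.one_le_rpow_sub
  exact lt_min (by positivity) (by positivity)

lemma overflowProb_le (h : LargeSystem α β k d N m)
    {w : Queues N → Finset (Fin N) → Fin N → ℝ} (hw : IsShortestQueueRule w) {pi : Queues N → ℝ}
    (hpi : IsStationary (params α β k d N) w pi) :
    arrivalExp (params α β k d N) w pi (overflowInd (m + 3)) ≤ 1 / (N : ℝ) ^ 2 := by
  have hδ := h.delta_pos
  have hδ1 := h.delta_le
  have hk : (0 : ℝ) < k := by exact_mod_cast h.tasks_pos
  have hN := h.N_pos
  have hx := h.one_le_rpow_alpha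
  have h1 := (h.admissible hw).overflowProb_le hpi (by positivity) (by
    rw [h.delta_eq, div_mul_eq_mul_div, div_div, div_le_one (by positivity)]
    have h1 := h.log_le
    have h2 := h.m_le
    have h3 : β * m ≤ 1 * m := by gcongr; exact h.beta_le
    linarith)
  refine h1.trans ?_
  have h2 : Real.exp (-(β * (N : ℝ) ^ (-α) * N / (16 * (params α β k d N).tasks))) ≤
      1 / (N : ℝ) ^ 4 := by
    rw [← h.exp_neg_four_log]
    apply Real.exp_le_exp.2
    rw [neg_le_neg_iff]
    change _ ≤ _ / (16 * (k : ℝ))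
    rw [le_div_iff₀ (by positivity)]
    have h1 := h.tasks_log_le
    have h4 : (β * (N : ℝ) ^ (-α)) ^ 2 * N ≤ β * (N : ℝ) ^ (-α) * N := by
      gcongr
      nlinarith
    have h5 := mul_pos (show 0 < Real.log N by linarith [h.log_ge]) hk
    linarith
  have h3 : 32 / (β * (N : ℝ) ^ (-α)) ≤ (N : ℝ) ^ 2 / 8 := by
    have := h.le_delta
    rw [div_le_iff₀ (by positivity)] at this
    rw [div_le_div_iff₀ hδ (by norm_num)]
    linarith
  calc _ ≤ (N : ℝ) ^ 2 / 8 * (1 / (N : ℝ) ^ 4) + 1 / (N : ℝ) ^ 4 := by gcongr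
    _ = (1 / 8 + 1 / (N : ℝ) ^ 2) * (1 / (N : ℝ) ^ 2) := by field_simp
    _ ≤ 1 * (1 / (N : ℝ) ^ 2) := by
        gcongr
        have : 1 / (N : ℝ) ^ 2 ≤ 1 / 2 := by
          apply one_div_le_one_div_of_le (by norm_num)
          nlinarith [h.N_ge]
        linarith
    _ = _ := one_mul _

lemma dropProb_le (h : LargeSystem α β k d N m)
    {w : Queues N → Finset (Fin N) → Fin N → ℝ} (hw : IsShortestQueueRule w) {pi : Queues N → ℝ}
    (hpi : IsStationary (params α β k d N) w pi) :
    dropProb (params α β k d N) w pi ≤ 1 / (N : ℝ) ^ 2 :=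
  ((h.admissible hw).dropProb_le hpi h.cap_ge).trans (h.overflowProb_le hw hpi)

/-- The bound N^(-2) is much stronger than needed, since b ≤ √N and log N ≤ N. -/
lemma dropProb_le_buffer (h : LargeSystem α β k d N m)
    {w : Queues N → Finset (Fin N) → Fin N → ℝ} (hw : IsShortestQueueRule w) {pi : Queues N → ℝ}
    (hpi : IsStationary (params α β k d N) w pi) :
    dropProb (params α β k d N) w pi ≤ 11 / (buffer α k N * Real.sqrt N * Real.log N) := by
  refine (h.dropProb_le hw hpi).trans ?_
  have hN := h.N_pos
  have hb := h.buffer_pos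
  have hL : 0 < Real.log N := by linarith [h.log_ge]
  have hs : 0 < Real.sqrt N := Real.sqrt_pos.2 hN
  rw [div_le_div_iff₀ (by positivity) (by positivity), one_mul]
  calc buffer α k N * Real.sqrt N * Real.log N ≤ Real.sqrt N * Real.sqrt N * N := by
        gcongr
        · exact (min_le_left _ _).trans h.rpow_alpha_le
        · exact h.log_le_N
    _ = 1 * (N : ℝ) ^ 2 := by rw [Real.mul_self_sqrt hN.le]; ring
    _ ≤ 11 * (N : ℝ) ^ 2 := by gcongr; norm_num

lemma inv_sq_le (h : LargeSystem α β k d N m) : 1 / (N : ℝ) ^ 2 ≤ 1 / N := by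
  apply one_div_le_one_div_of_le h.N_pos
  nlinarith [h.one_le_N]

lemma inv_sq_lt_one (h : LargeSystem α β k d N m) : 1 / (N : ℝ) ^ 2 < 1 := by
  refine h.inv_sq_le.trans_lt ?_
  rw [div_lt_one h.N_pos]
  linarith [h.N_ge]

lemma le_meanDelayAdmitted (h : LargeSystem α β k d N m)
    {w : Queues N → Finset (Fin N) → Fin N → ℝ} (hw : IsShortestQueueRule w) {pi : Queues N → ℝ}
    (hpi : IsStationary (params α β k d N) w pi) {s : ℝ} (hs : 0 ≤ s) :
    s * (1 - (1 - Real.exp (-s)) ^ k) ≤ meanDelayAdmitted (params α β k d N) w pi :=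
  (h.admissible hw).le_meanDelayAdmitted hpi ((h.dropProb_le hw hpi).trans_lt h.inv_sq_lt_one) hs

lemma meanDelayAdmitted_le (h : LargeSystem α β k d N m)
    {w : Queues N → Finset (Fin N) → Fin N → ℝ} (hw : IsShortestQueueRule w) {pi : Queues N → ℝ}
    (hpi : IsStationary (params α β k d N) w pi) {η : ℝ} (h0 : 0 < η) (h1 : η < 1) :
    meanDelayAdmitted (params α β k d N) w pi ≤
      ((Real.log k + (m + 3) * Real.log η⁻¹) / (1 - η) + 4 / N) / (1 - 1 / N) := by
  have h2 := (h.admissible hw).meanDelayAdmitted_le hpi h.cap_ge (h.overflowProb_le hw hpi)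
    h.inv_sq_lt_one h0 h1
  have hN := h.N_pos
  have hN1 : 1 / (N : ℝ) < 1 := by
    rw [div_lt_one hN]
    linarith [h.N_ge]
  have hk : (0 : ℝ) < k := by exact_mod_cast h.tasks_pos
  have hk0 : 0 ≤ Real.log k := Real.log_natCast_nonneg _
  have hη : 0 ≤ Real.log η⁻¹ := Real.log_nonneg ((one_le_inv₀ h0).2 h1.le)
  refine h2.trans ?_
  push_cast
  have hB : 0 ≤ (Real.log k + (m + 3) * Real.log η⁻¹) / (1 - η) :=
    div_nonneg (by positivity) (by linarith)
  refine div_le_div₀ (by positivity) (add_le_add le_rfl ?_) (by linarith)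
    (by linarith [h.inv_sq_le])
  -- Both log k and `cap` are at most N, so a job with overflow costs at most 4N in the mean.
  change 1 / (N : ℝ) ^ 2 * ((Real.log k + (params α β k d N).cap * Real.log (1 / 2)⁻¹) /
    (1 - 1 / 2)) ≤ 4 / N
  have hcap : ((params α β k d N).cap : ℝ) ≤ N :=
    (Nat.floor_le h.buffer_pos.le).trans
      ((min_le_left _ _).trans (h.rpow_alpha_le.trans h.sqrt_le_N))
  have hkN : Real.log k ≤ N := by
    have h3 := Real.log_le_sub_one_of_pos hk
    have h4 := h.tasks_log_le
    have h5 : (β * (N : ℝ) ^ (-α)) ^ 2 ≤ 1 := pow_le_one₀ h.delta_pos.le h.delta_le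
    have h6 : (β * (N : ℝ) ^ (-α)) ^ 2 * N ≤ 1 * N := by gcongr
    have h7 : k ≤ 256 * Real.log N * k := le_mul_of_one_le_left hk.le (by linarith [h.log_ge])
    linarith
  have hlog2 : Real.log (1 / 2 : ℝ)⁻¹ ≤ 1 := by
    have := Real.log_le_sub_one_of_pos (x := (1 / 2 : ℝ)⁻¹) (by norm_num)
    norm_num at this ⊢
    linarith
  calc _ ≤ 1 / (N : ℝ) ^ 2 * ((N + N * 1) / (1 - 1 / 2)) := by
        have : (0 : ℝ) < 1 - 1 / 2 := by norm_num
        have : 0 ≤ Real.log (1 / 2 : ℝ)⁻¹ := Real.log_nonneg (by norm_num)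
        gcongr
    _ = _ := by field_simp; norm_num

end LargeSystem

end BatchFilling
end
noncomputable section
namespace BatchFilling

/-! ### Asymptotics -/

lemma tendsto_log_natCast : Tendsto (fun N : ℕ => Real.log N) atTop atTop :=
  Real.tendsto_log_atTop.comp tendsto_natCast_atTop_atTop

lemma eventually_log_pos_of_div_log {k : ℕ → ℕ}
    (hk' : ∃ c : ℝ, 0 < c ∧ ∀ᶠ N : ℕ in atTop, c * Real.log N ≤ (k N : ℝ) / Real.log (k N)) :
    ∀ᶠ N in atTop, 0 < k N ∧ 0 < Real.log (k N) := by
  obtain ⟨c, hc, h⟩ := hk'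
  filter_upwards [h, tendsto_log_natCast.eventually_gt_atTop 0] with N h1 h2
  -- Division by zero gives 0, so a positive quotient excludes k = 0 and k = 1, where the logarithm
  -- is 0.
  have h3 : 0 < (k N : ℝ) / Real.log (k N) := (mul_pos hc h2).trans_le h1
  have h4 : 0 ≤ Real.log (k N) := Real.log_natCast_nonneg _
  refine ⟨Nat.pos_of_ne_zero fun h => ?_, h4.lt_of_ne fun h => ?_⟩
  · simp [h] at h3
  · simp [← h] at h3

lemma tendsto_log_of_div_log {k : ℕ → ℕ}
    (hk' : ∃ c : ℝ, 0 < c ∧ ∀ᶠ N : ℕ in atTop, c * Real.log N ≤ (k N : ℝ) / Real.log (k N)) :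
    Tendsto (fun N => Real.log (k N)) atTop atTop := by
  refine Real.tendsto_log_atTop.comp ?_
  obtain ⟨c, hc, h⟩ := id hk'
  have hlog2 : 0 < Real.log 2 := Real.log_pos (by norm_num)
  refine tendsto_atTop_mono' _ ?_
    (tendsto_log_natCast.const_mul_atTop (mul_pos hc hlog2))
  filter_upwards [h, eventually_log_pos_of_div_log hk',
    tendsto_log_natCast.eventually_gt_atTop 0] with N h1 ⟨h2, h3⟩ h4
  rw [le_div_iff₀ h3] at h1
  have hk2 : (2 : ℝ) ≤ k N := by
    have : 2 ≤ k N := by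
      by_contra hlt
      have : k N = 1 := by omega
      simp [this] at h3
    exact_mod_cast this
  have h5 : Real.log 2 ≤ Real.log (k N) := Real.log_le_log (by norm_num) hk2
  calc c * Real.log 2 * Real.log N = c * Real.log N * Real.log 2 := by ring
    _ ≤ c * Real.log N * Real.log (k N) := by gcongr
    _ ≤ _ := h1

lemma eventually_ceil_add_le {k : ℕ → ℕ} {h : ℕ → ℝ} (hh : Tendsto h atTop atTop)
    (hk : Tendsto (fun N => Real.log (k N)) atTop atTop)
    (ho : h =o[atTop] fun N => Real.log (k N)) {ζ : ℝ} (hζ : 0 < ζ) :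
    ∀ᶠ N in atTop, (⌈h N⌉₊ : ℝ) + 3 ≤ ζ * Real.log (k N) := by
  filter_upwards [ho.bound (half_pos hζ), hh.eventually_ge_atTop 0,
    (hk.const_mul_atTop (half_pos hζ)).eventually_ge_atTop 4] with N h1 h2 h3
  have h4 : 0 ≤ Real.log (k N) := Real.log_natCast_nonneg _
  rw [Real.norm_of_nonneg h2, Real.norm_of_nonneg h4] at h1
  have h5 := Nat.ceil_lt_add_one h2
  linarith

/-- The two conditions on k and h meet in `le_tasks`: k ≥ c log N log k, and m + 3 ≤ (c/20) log k
because h = o(log k). The other fields express growth in N. -/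
lemma eventually_largeSystem {α β : ℝ} (hα : 0 < α) (hα' : α < 1 / 2) (hβ : 0 < β) (hβ' : β ≤ 1)
    {k : ℕ → ℕ}
    (hk : (fun N => (k N : ℝ)) =o[atTop]
      fun N : ℕ => (N : ℝ) ^ ((1 : ℝ) / 2 - α) / Real.log N ^ 2)
    (hk' : ∃ c : ℝ, 0 < c ∧ ∀ᶠ N : ℕ in atTop, c * Real.log N ≤ (k N : ℝ) / Real.log (k N))
    {d h : ℕ → ℝ} (hh : Tendsto h atTop atTop) (ho : h =o[atTop] fun N => Real.log (k N))
    (hd : ∀ᶠ N : ℕ in atTop, 8 / ((1 - load α β N) * h N) ≤ d N) :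
    ∀ᶠ N in atTop, LargeSystem α β (k N) (d N) N ⌈h N⌉₊ := by
  have hlogk := tendsto_log_of_div_log hk'
  have hpos := eventually_log_pos_of_div_log hk'
  obtain ⟨c, hc, hk'⟩ := hk'
  have hlogN : ∀ᶠ N : ℕ in atTop, ‖Real.log (N : ℝ)‖ ≤ 1 * ‖(N : ℝ) ^ α‖ :=
    tendsto_natCast_atTop_atTop.eventually ((isLittleO_log_rpow_atTop hα).bound one_pos)
  filter_upwards [hk', hpos, hlogN, hk.bound one_pos, hd, hh.eventually_ge_atTop 1,
    tendsto_log_natCast.eventually_ge_atTop (256 / β ^ 2),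
    tendsto_log_natCast.eventually_ge_atTop 1,
    eventually_ceil_add_le hh hlogk ho (show 0 < c / 20 by positivity),
    eventually_ceil_add_le hh hlogk ho one_pos, eventually_ge_atTop 1]
    with N h1 ⟨h2, h3⟩ h4 h5 h6 h7 h8 h9 h10 h11 h12
  have hN : (1 : ℝ) ≤ N := by exact_mod_cast h12
  have hL : 0 < Real.log N := by linarith
  have hk0 : (0 : ℝ) < k N := by exact_mod_cast h2
  have htasks : k N * Real.log N ^ 2 ≤ (N : ℝ) ^ ((1 : ℝ) / 2 - α) := by
    rw [one_mul, Real.norm_of_nonneg hk0.le, Real.norm_of_nonneg (by positivity),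
      le_div_iff₀ (by positivity)] at h5
    exact h5
  refine ⟨hα, hα', hβ, hβ', ?_, ?_, h2, htasks, ?_, Nat.ceil_pos.2 (by linarith), ?_, ?_⟩
  · rw [div_le_iff₀ (by positivity)] at h8
    linarith
  · rwa [one_mul, Real.norm_of_nonneg hL.le, Real.norm_of_nonneg (by positivity)] at h4
  · rw [le_div_iff₀ h3] at h1
    have := mul_le_mul_of_nonneg_left h10 (show 0 ≤ 20 * Real.log N by positivity)
    linarith
  · rw [one_mul] at h11
    refine h11.trans (Real.log_le_log hk0 ?_)
    calc (k N : ℝ) ≤ k N * Real.log N ^ 2 := le_mul_of_one_le_right hk0.le (one_le_pow₀ h9)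
      _ ≤ (N : ℝ) ^ ((1 : ℝ) / 2 - α) := htasks
      _ ≤ (N : ℝ) ^ (1 : ℝ) := Real.rpow_le_rpow_of_exponent_le hN (by linarith)
      _ = N := Real.rpow_one _
  · refine le_trans ?_ h6
    have h13 : 1 - load α β N = β * (N : ℝ) ^ (-α) := by rw [load]; ring
    rw [h13]
    have h14 : 0 < (N : ℝ) ^ (-α) := Real.rpow_pos_of_pos (by linarith) _
    gcongr
    exact Nat.le_ceil _

/-- With s = (1-η) log k one has (1 - e^(-s))^k ≤ exp(-k e^(-s)) = exp(-k^η). As k^η ≥ η log k ≥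
1/η, this is at most e^(-1/η) ≤ η. -/
lemma one_sub_exp_neg_pow_le {k : ℕ} (hk : 0 < k) {η : ℝ} (h0 : 0 < η) (h1 : η < 1)
    (h : 1 ≤ η ^ 2 * Real.log k) :
    (1 - η) ^ 2 * Real.log k ≤ (1 - η) * Real.log k *
      (1 - (1 - Real.exp (-((1 - η) * Real.log k))) ^ k) := by
  have hk0 : (0 : ℝ) < k := by exact_mod_cast hk
  have hl : 0 ≤ Real.log k := Real.log_natCast_nonneg _
  set s := (1 - η) * Real.log k with hs
  have hs0 : 0 ≤ s := mul_nonneg (by linarith) hl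
  have h2 : (1 - Real.exp (-s)) ^ k ≤ η := by
    have h3 : 1 - Real.exp (-s) ≤ Real.exp (-Real.exp (-s)) := by
      have := Real.add_one_le_exp (-Real.exp (-s))
      linarith
    have h4 : 0 ≤ 1 - Real.exp (-s) := by
      have : Real.exp (-s) ≤ 1 := Real.exp_le_one_iff.2 (by linarith)
      linarith
    have h5 : (k : ℝ) * Real.exp (-s) = Real.exp (η * Real.log k) := by
      nth_rewrite 1 [← Real.exp_log hk0]
      rw [← Real.exp_add, hs]
      ring_nf
    have h6 : η⁻¹ ≤ Real.exp (η * Real.log k) := by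
      have := Real.add_one_le_exp (η * Real.log k)
      have h7 : η⁻¹ ≤ η * Real.log k := by
        rw [inv_le_iff_one_le_mul₀ h0]
        linarith
      linarith
    calc (1 - Real.exp (-s)) ^ k ≤ Real.exp (-Real.exp (-s)) ^ k := by gcongr
      _ = Real.exp (-Real.exp (η * Real.log k)) := by
          rw [← Real.exp_nat_mul, mul_neg, h5]
      _ ≤ Real.exp (-η⁻¹) := by gcongr
      _ = (Real.exp η⁻¹)⁻¹ := Real.exp_neg _
      _ ≤ (η⁻¹)⁻¹ := by
          have := Real.add_one_le_exp η⁻¹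
          gcongr
          linarith
      _ = η := inv_inv η
  calc (1 - η) ^ 2 * Real.log k = s * (1 - η) := by rw [hs]; ring
    _ ≤ _ := by gcongr

/-- A quantity with these bounds for all `η` is asymptotic to `log k`. -/
lemma isLittleO_sub_log {k : ℕ → ℕ} (hk : Tendsto (fun N => Real.log (k N)) atTop atTop)
    {D : ℕ → ℝ}
    (hlow : ∀ s : ℕ → ℝ, (∀ N, 0 ≤ s N) →
      ∀ᶠ N in atTop, s N * (1 - (1 - Real.exp (-s N)) ^ k N) ≤ D N)
    (hup : ∀ η : ℝ, 0 < η → η < 1 → ∀ᶠ N in atTop,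
      D N ≤ (((1 + η) * Real.log (k N)) / (1 - η) + η * Real.log (k N)) / (1 - η)) :
    (fun N => D N - Real.log (k N)) =o[atTop] fun N => Real.log (k N) := by
  rw [isLittleO_iff]
  intro c hc
  set η := min (c / 10) (1 / 10) with hη
  have h0 : 0 < η := lt_min (by positivity) (by norm_num)
  have h1 : η ≤ 1 / 10 := min_le_right _ _
  have h2 : 10 * η ≤ c := by
    have : η ≤ c / 10 := min_le_left _ _
    linarith
  filter_upwards [hlow (fun N => (1 - η) * Real.log (k N)) fun N =>
      mul_nonneg (by linarith) (Real.log_natCast_nonneg _), hup η h0 (by linarith),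
    (hk.const_mul_atTop (pow_pos h0 2)).eventually_ge_atTop 1, hk.eventually_gt_atTop 0]
    with N h3 h4 h5 h6
  have hkN : 0 < k N := Nat.pos_of_ne_zero fun h => by simp [h] at h6
  have h7 := (one_sub_exp_neg_pow_le hkN h0 (by linarith) h5).trans h3
  set l := Real.log (k N) with hl
  have h8 : ((1 + η) * l / (1 - η) + η * l) / (1 - η) ≤ (1 + 10 * η) * l := by
    have h9 : 0 < 1 - η := by linarith
    rw [div_le_iff₀ h9, div_add' _ _ _ h9.ne', div_le_iff₀ h9]
    have h10 : 0 ≤ l * (η * (6 - 18 * η + 10 * η ^ 2)) := by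
      have : 0 ≤ 6 - 18 * η + 10 * η ^ 2 := by nlinarith
      positivity
    linarith
  have h9 : η * l ≤ c / 10 * l := mul_le_mul_of_nonneg_right (min_le_left _ _) h6.le
  have h10 : 0 ≤ η ^ 2 * l := by positivity
  rw [Real.norm_of_nonneg h6.le, Real.norm_eq_abs, abs_le]
  constructor <;> linarith [mul_pos hc h6]

lemma isLittleO_meanDelayAdmitted_sub_log {α β : ℝ} {k : ℕ → ℕ} {d h : ℕ → ℝ}
    (hk : Tendsto (fun N => Real.log (k N)) atTop atTop)
    (hh : Tendsto h atTop atTop) (ho : h =o[atTop] fun N => Real.log (k N))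
    {w : ∀ N : ℕ, Queues N → Finset (Fin N) → Fin N → ℝ} (hw : ∀ N, IsShortestQueueRule (w N))
    {pi : ∀ N : ℕ, Queues N → ℝ}
    (hpi : ∀ᶠ N : ℕ in atTop, IsStationary (params α β (k N) (d N) N) (w N) (pi N))
    (hL : ∀ᶠ N in atTop, LargeSystem α β (k N) (d N) N ⌈h N⌉₊) :
    (fun N => meanDelayAdmitted (params α β (k N) (d N) N) (w N) (pi N) - Real.log (k N))
      =o[atTop] fun N => Real.log (k N) := by
  refine isLittleO_sub_log hk (fun s hs => ?_) fun η h0 h1 => ?_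
  · filter_upwards [hL, hpi] with N hL hpi
    exact hL.le_meanDelayAdmitted (hw N) hpi (hs N)
  · have hη : 0 ≤ Real.log η⁻¹ := Real.log_nonneg ((one_le_inv₀ h0).2 h1.le)
    have hinv : Tendsto (fun N : ℕ => 1 / (N : ℝ)) atTop (𝓝 0) :=
      tendsto_one_div_atTop_nhds_zero_nat
    filter_upwards [hL, hpi,
      eventually_ceil_add_le hh hk ho (show 0 < η / (Real.log η⁻¹ + 1) by positivity),
      hinv.eventually_le_const (show 0 < η / 4 by positivity), hk.eventually_ge_atTop 1]
      with N hL hpi h3 h4 h5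
    refine (hL.meanDelayAdmitted_le (hw N) hpi h0 h1).trans ?_
    have h6 : ((⌈h N⌉₊ : ℝ) + 3) * Real.log η⁻¹ ≤ η * Real.log (k N) := by
      rw [div_mul_eq_mul_div, le_div_iff₀ (by positivity)] at h3
      have : (0 : ℝ) ≤ (⌈h N⌉₊ : ℝ) + 3 := by positivity
      linarith
    have h7 : 4 / (N : ℝ) ≤ η * Real.log (k N) := by
      have h8 : 4 / (N : ℝ) = 4 * (1 / N) := by ring
      have h9 : η * 1 ≤ η * Real.log (k N) := by gcongr
      linarith
    have h8 : 0 < 1 - η := by linarith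
    have h9 : 1 / (N : ℝ) ≤ η := by linarith
    have h10 : 0 ≤ Real.log (k N) := by linarith
    refine div_le_div₀ (by positivity) (add_le_add ?_ h7) h8 (by linarith)
    gcongr
    linarith

lemma isLittleO_meanInherentDelay_sub_log {k : ℕ → ℕ}
    (hk : Tendsto (fun N => Real.log (k N)) atTop atTop) :
    (fun N => meanInherentDelay (k N) - Real.log (k N)) =o[atTop] fun N => Real.log (k N) := by
  have hpos : ∀ᶠ N in atTop, 0 < k N := by
    filter_upwards [hk.eventually_gt_atTop 0] with N h
    exact Nat.pos_of_ne_zero fun h' => by simp [h'] at h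
  refine isLittleO_sub_log hk (fun s hs => ?_) fun η h0 h1 => ?_
  · filter_upwards [hpos] with N hN
    exact le_meanInherentDelay (hs N) hN
  · filter_upwards [hpos, (hk.const_mul_atTop h0).eventually_ge_atTop (Real.log η⁻¹),
      hk.eventually_ge_atTop 0] with N h2 h3 h4
    refine (meanInherentDelay_le h0 h1 h2).trans ?_
    have h5 : 0 < 1 - η := by linarith
    have h6 : (Real.log (k N) + Real.log η⁻¹) / (1 - η) ≤
        (1 + η) * Real.log (k N) / (1 - η) := by
      gcongr
      linarith
    have h7 : 0 ≤ (1 + η) * Real.log (k N) / (1 - η) + η * Real.log (k N) := by positivity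
    have h8 : 0 ≤ η * Real.log (k N) := by positivity
    calc _ ≤ (1 + η) * Real.log (k N) / (1 - η) + η * Real.log (k N) := by linarith
      _ ≤ _ := le_div_self h7 h5 (by linarith)

/-- If the probe overhead is `ω(1 / ((1 - load) log k))`, then it is at least
`8 / ((1 - load) h)` for some `h → ∞` with `h = o(log k)`. -/
lemma exists_level {α β : ℝ} (hβ : 0 < β) {k : ℕ → ℕ}
    (hk : Tendsto (fun N => Real.log (k N)) atTop atTop) {d : ℕ → ℝ}
    (hd : Tendsto (fun N => d N / (1 / ((1 - load α β N) * Real.log (k N)))) atTop atTop) :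
    ∃ h : ℕ → ℝ, Tendsto h atTop atTop ∧ (h =o[atTop] fun N => Real.log (k N)) ∧
      ∀ᶠ N : ℕ in atTop, 8 / ((1 - load α β N) * h N) ≤ d N := by
  set r : ℕ → ℝ := fun N => d N / (1 / ((1 - load α β N) * Real.log (k N))) with hr
  -- By hypothesis r → ∞. The first entry of the maximum is the h for which the overhead condition
  -- holds with equality, and it is o(log k). The second entry forces h → ∞.
  refine ⟨fun N => max (8 * Real.log (k N) / r N) (Real.sqrt (Real.log (k N))), ?_, ?_, ?_⟩
  · exact tendsto_atTop_mono (fun N => le_max_right _ _) (Real.tendsto_sqrt_atTop.comp hk)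
  · rw [isLittleO_iff]
    intro c hc
    filter_upwards [hd.eventually_ge_atTop (8 / c), hd.eventually_gt_atTop 0,
      hk.eventually_ge_atTop (1 / c ^ 2), hk.eventually_gt_atTop 0] with N h1 h2 h3 h4
    rw [Real.norm_of_nonneg (le_max_of_le_right (Real.sqrt_nonneg _)), Real.norm_of_nonneg h4.le]
    refine max_le ?_ ?_
    · rw [div_le_iff₀ hc] at h1
      rw [div_le_iff₀ h2]
      have := mul_le_mul_of_nonneg_right h1 h4.le
      linarith
    · rw [div_le_iff₀ (by positivity)] at h3
      refine Real.sqrt_le_iff.2 ⟨by positivity, ?_⟩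
      have := mul_le_mul_of_nonneg_right h3 h4.le
      linarith
  · filter_upwards [hd.eventually_gt_atTop 0, hk.eventually_gt_atTop 0, eventually_gt_atTop 0]
      with N h1 h2 h3
    have hδ : 0 < 1 - load α β N := by
      have : 0 < (N : ℝ) ^ (-α) := Real.rpow_pos_of_pos (by exact_mod_cast h3) _
      have h4 : 1 - load α β N = β * (N : ℝ) ^ (-α) := by rw [load]; ring
      rw [h4]; positivity
    have hdr : d N = r N / ((1 - load α β N) * Real.log (k N)) := by
      rw [hr]; field_simp
    calc 8 / ((1 - load α β N) *
          max (8 * Real.log (k N) / r N) (Real.sqrt (Real.log (k N))))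
        ≤ 8 / ((1 - load α β N) * (8 * Real.log (k N) / r N)) := by
          have : 0 < r N := h1
          gcongr
          exact le_max_left _ _
      _ = d N := by
          have : r N ≠ 0 := h1.ne'
          rw [hdr]; field_simp

end BatchFilling
end

/-! ### The main theorem -/

theorem theorem2 (α β : ℝ) (hα : 0 < α) (hα' : α < 1 / 2) (hβ : 0 < β) (hβ' : β ≤ 1)
    (k : ℕ → ℕ)
    (hk : (fun N => (k N : ℝ)) =o[atTop]
      fun N : ℕ => (N : ℝ) ^ ((1 : ℝ) / 2 - α) / Real.log N ^ 2)
    (hk' : ∃ c : ℝ, 0 < c ∧ ∀ᶠ N : ℕ in atTop, c * Real.log N ≤ (k N : ℝ) / Real.log (k N))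
    (d : ℕ → ℝ)
    (w : ∀ N : ℕ, BatchFilling.Queues N → Finset (Fin N) → Fin N → ℝ)
    (hw : ∀ N, BatchFilling.IsShortestQueueRule (w N))
    (pi : ∀ N : ℕ, BatchFilling.Queues N → ℝ)
    (hpi : ∀ᶠ N : ℕ in atTop,
      BatchFilling.IsStationary (BatchFilling.params α β (k N) (d N) N) (w N) (pi N)) :
    (∀ h : ℕ → ℝ, Tendsto h atTop atTop →
      h =o[atTop] (fun N => Real.log (k N)) →
      (∀ᶠ N : ℕ in atTop, 8 / ((1 - BatchFilling.load α β N) * h N) ≤ d N) →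
      (fun N => BatchFilling.meanDelayAdmitted (BatchFilling.params α β (k N) (d N) N) (w N) (pi N)
          - Real.log (k N)) =o[atTop] (fun N => Real.log (k N)) ∧
      ∀ᶠ N : ℕ in atTop,
        BatchFilling.dropProb (BatchFilling.params α β (k N) (d N) N) (w N) (pi N) ≤
          11 / (BatchFilling.buffer α (k N) N * Real.sqrt N * Real.log N)) ∧
    (Tendsto (fun N => d N / (1 / ((1 - BatchFilling.load α β N) * Real.log (k N)))) atTop atTop →
      Tendsto (fun N =>
        (BatchFilling.meanDelayAdmitted (BatchFilling.params α β (k N) (d N) N) (w N) (pi N)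
          - BatchFilling.meanInherentDelay (k N)) / BatchFilling.meanInherentDelay (k N))
        atTop (𝓝 0)) := by
  have hlogk := BatchFilling.tendsto_log_of_div_log hk'
  have part1 : ∀ h : ℕ → ℝ, Tendsto h atTop atTop →
      h =o[atTop] (fun N => Real.log (k N)) →
      (∀ᶠ N : ℕ in atTop, 8 / ((1 - BatchFilling.load α β N) * h N) ≤ d N) →
      (fun N => BatchFilling.meanDelayAdmitted (BatchFilling.params α β (k N) (d N) N) (w N) (pi N)
          - Real.log (k N)) =o[atTop] (fun N => Real.log (k N)) ∧
      ∀ᶠ N : ℕ in atTop,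
        BatchFilling.dropProb (BatchFilling.params α β (k N) (d N) N) (w N) (pi N) ≤
          11 / (BatchFilling.buffer α (k N) N * Real.sqrt N * Real.log N) := by
    intro h hh ho hd
    have hL := BatchFilling.eventually_largeSystem hα hα' hβ hβ' hk hk' hh ho hd
    refine ⟨BatchFilling.isLittleO_meanDelayAdmitted_sub_log hlogk hh ho hw hpi hL, ?_⟩
    filter_upwards [hL, hpi] with N hL hpi
    exact hL.dropProb_le_buffer (hw N) hpi
  refine ⟨part1, fun hd => ?_⟩
  obtain ⟨h, hh, ho, hdh⟩ := BatchFilling.exists_level hβ hlogk hd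
  have h1 := (part1 h hh ho hdh).1
  have h2 := BatchFilling.isLittleO_meanInherentDelay_sub_log hlogk
  -- Both means are log k + o(log k), so they differ by o(log k), which is also negligible relative
  -- to the inherent delay.
  have h3 := (h1.sub h2).congr_left fun N => sub_sub_sub_cancel_right
    (BatchFilling.meanDelayAdmitted (BatchFilling.params α β (k N) (d N) N) (w N) (pi N))
    (BatchFilling.meanInherentDelay (k N)) (Real.log (k N))
  exact (h3.trans_isBigO (IsEquivalent.isBigO_symm h2)).tendsto_div_nhds_zero
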